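/- Let $\Omega=(a_1,a_2)$ with $a_1<0<a_2$, let $\delta>0$, $\Omega_I=(a_1-\delta,a_1]\cup[a_2,a_2+\delta)$, and for $x\in\Omega$ put $$Lu(x)=\int_{\Omega\cup\Omega_I}(u(y)-u(x))\,K(x-y)\,dy .$$ Let the kernel $K:\mathbb R\to[0,\infty)$ be even and integrable, with $K(x)=0$ for $|x|\ge\delta$; let $K$ be $C^\infty$ on $(-\delta,0)$ and on $(0,\delta)$, with finite one-sided limits at $-\delta$ and $\delta$ from inside $(-\delta,\delta)$ (so that a jump at $\pm\delta$ is allowed). Assume moreover that $K\in L^\infty(\mathbb R)$, that its (a.e. classical) derivative satisfies $K'\in L^2(\mathbb R)$, and that $K'$ is singular at the origin, i.e. unbounded in $(0,\varepsilon)$ and in $(-\varepsilon,0)$ for every $\varepsilon>0$. Assume finally that $\pm\delta\in\Omega$ if $K$ is discontinuous at $\pm\delta$, and that $a_1\ne-\delta$ and $a_2\neq\delta$ if $K'$ is unbounded near $\pm\delta$. Say that $g$ satisfies Assumption (B) with $N$ if $g$ has a jump discontinuity at $0$ (both one-sided limits exist, are finite, and differ), $g$ is $C^N$ on $(a_1,0)$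 and on $(0,a_2)$, and $g,g',\dots,g^{(N)}$ are bounded on $(a_1,0)\cup(0,a_2)$. Let $N\ge2$. 1. Suppose that $f$ satisfies Assumption (B) with $N$ and that $b\in W^{1,2}(\Omega_I)$. Let $u\in L^2(\Omega\cup\Omega_I)$ be a solution of $Lu=f$ in $\Omega$, $u=b$ in $\Omega_I$ (almost everywhere). Then $u$ agrees almost everywhere in $\Omega$ with a function (again denoted $u$) that is $C^2$ in a punctured neighbourhood of $0$, and $u''$ is unbounded on each side of $0$ in every neighbourhood of $0$. If $|K'(0^\pm)|=\infty$, in the sense that $|K'(x)|\to\infty$ as $x\to0^\pm$, then $|u''(0^\pm)|=\infty$ in the same sense. 2. Suppose that $u\in L^2(\Omega\cup\Omega_I)$ satisfies Assumption (B) with $N$, and, in case $\pm\delta$ do not both belong to $\Omega$, that $u\in W^{1,2}(\Omega_I)$. Then $f:=Lu$ is $C^2$ in a punctured neighbourhood of $0$, and $f''$ is unbounded on each side of $0$ in every neighbourhood of $0$. If $|K'(0^\pm)|=\infty$, then $|f''(0^\pm)|=\infty$. -/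

import Mathlib

open MeasureTheory Filter Topology Set
open scoped ContDiff

/-- The domain `Ω = (a₁, a₂)`. -/
def dom (a₁ a₂ : ℝ) : Set ℝ := Ioo a₁ a₂

/-- The interaction region `Ω_I = (a₁ - δ, a₁] ∪ [a₂, a₂ + δ)`. -/
def collar (δ a₁ a₂ : ℝ) : Set ℝ := Ioc (a₁ - δ) a₁ ∪ Ico a₂ (a₂ + δ)

/-- The nonlocal operator `Lu(x) = ∫_{Ω ∪ Ω_I} (u(y) - u(x)) K(x - y) dy`. -/
noncomputable def nonlocalOp (K : ℝ → ℝ) (δ a₁ a₂ : ℝ) (u : ℝ → ℝ) (x : ℝ) : ℝ :=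
  ∫ y in dom a₁ a₂ ∪ collar δ a₁ a₂, (u y - u x) * K (x - y)

/-- Assumption (A1): a nonnegative, radial, integrable kernel with horizon `δ`. -/
structure AssumptionA1 (δ : ℝ) (K : ℝ → ℝ) : Prop where
  radial : ∀ x, K (-x) = K x
  nonneg : ∀ x, 0 ≤ K x
  zero_of_le : ∀ x, δ ≤ |x| → K x = 0
  integrable : Integrable K volume

/-- Assumption (A2): `K` is smooth on `(-δ, 0)` and `(0, δ)`, and is continuous up to the horizon
points `±δ` from inside, that is, the finite one-sided limits there exist. They may differ from the
value `K (±δ) = 0`, so a jump of `K` at `±δ` is allowed. -/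
structure AssumptionA2 (δ : ℝ) (K : ℝ → ℝ) : Prop where
  smooth_left : ContDiffOn ℝ ∞ K (Ioo (-δ) 0)
  smooth_right : ContDiffOn ℝ ∞ K (Ioo 0 δ)
  limit_left : ∃ l, Tendsto K (𝓝[>] (-δ)) (𝓝 l)
  limit_right : ∃ l, Tendsto K (𝓝[<] δ) (𝓝 l)

/-- `g` has a jump discontinuity at `p`: both one-sided limits exist, are finite, and differ. -/
def HasJumpAt (g : ℝ → ℝ) (p : ℝ) : Prop :=
  ∃ l r : ℝ, Tendsto g (𝓝[<] p) (𝓝 l) ∧ Tendsto g (𝓝[>] p) (𝓝 r) ∧ l ≠ r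

/-- Assumption (B) on `Ω = (a₁, a₂)` with order of smoothness `N`. -/
structure AssumptionB (a₁ a₂ : ℝ) (N : ℕ) (g : ℝ → ℝ) : Prop where
  jump : HasJumpAt g 0
  contDiff_left : ContDiffOn ℝ N g (Ioo a₁ 0)
  contDiff_right : ContDiffOn ℝ N g (Ioo 0 a₂)
  bounded : ∀ j ≤ N, ∃ C : ℝ, ∀ x ∈ Ioo a₁ 0 ∪ Ioo 0 a₂, |iteratedDeriv j g x| ≤ C

/-- The Sobolev space `W^{1,2}` on (the interior of) `U`, through weak derivatives. -/
def MemW12 (U : Set ℝ) (g : ℝ → ℝ) : Prop :=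
  MemLp g 2 (volume.restrict U) ∧
    ∃ g' : ℝ → ℝ, MemLp g' 2 (volume.restrict U) ∧
      ∀ φ : ℝ → ℝ, ContDiff ℝ ∞ φ → HasCompactSupport φ → tsupport φ ⊆ interior U →
        ∫ x in U, g x * deriv φ x = - ∫ x in U, g' x * φ x

/-- `u ∈ L²(Ω ∪ Ω_I)` solves `Lu = f` in `Ω`, `u = b` in `Ω_I` (almost everywhere). -/
structure IsNonlocalSolution (K : ℝ → ℝ) (δ a₁ a₂ : ℝ) (f b u : ℝ → ℝ) : Prop where
  memLp : MemLp u 2 (volume.restrict (dom a₁ a₂ ∪ collar δ a₁ a₂))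
  eq_in : ∀ᵐ x ∂volume.restrict (dom a₁ a₂), nonlocalOp K δ a₁ a₂ u x = f x
  eq_collar : ∀ᵐ x ∂volume.restrict (collar δ a₁ a₂), u x = b x

/-- `g` is unbounded near the origin, on each side of it. -/
def UnboundedAtZero (g : ℝ → ℝ) : Prop :=
  (∀ C : ℝ, ∃ᶠ x in 𝓝[>] (0 : ℝ), C < |g x|) ∧ (∀ C : ℝ, ∃ᶠ x in 𝓝[<] (0 : ℝ), C < |g x|)

/-- `|g(0⁺)| = ∞` and `|g(0⁻)| = ∞`, as one-sided limits. -/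
def InfiniteAtZero (g : ℝ → ℝ) : Prop :=
  Tendsto (fun x => |g x|) (𝓝[>] (0 : ℝ)) atTop ∧ Tendsto (fun x => |g x|) (𝓝[<] (0 : ℝ)) atTop

/-- `w` is twice continuously differentiable in a punctured neighbourhood of `0`; the second
derivative is unbounded on each side of `0`, and if the singularity of `K'` is in the sense
`|K'(0^±)| = ∞`, then also `|w''(0^±)| = ∞`. -/
def SecondDerivBlowUp (K w : ℝ → ℝ) : Prop :=
  (∀ᶠ x in 𝓝[≠] (0 : ℝ), ContDiffAt ℝ 2 w x) ∧
    UnboundedAtZero (iteratedDeriv 2 w) ∧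
    (InfiniteAtZero (deriv K) → InfiniteAtZero (iteratedDeriv 2 w))

/-! Write M = ∫ K and let U be u cut off outside Ω ∪ Ω_I. For x in Ω the operator is Lu(x) = (U *
K)(x) - M u(x) (`nonlocalOp_eq`), so everything rests on the second derivative of U * K near 0.

Suppose that U is piecewise a primitive, with jumps c p at finitely many points p and a density h in
L². The first derivative falls on U: (U * K)' = ∑ c p K(· - p) + h * K. Since h is only square
integrable, the second one falls on K, whose distributional derivative is K' together with jumps κ
at -δ and -κ at δ (`kernel_isPrim`). Hence (U * K)'' = c 0 K' + ∑_{p ≠ 0} c p K'(· - p) + κ (h(· +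
δ) - h(· - δ)) + K' * h. The last term is continuous as a convolution of L² functions, and the
assumptions on ±δ keep the two middle ones bounded near 0 (`iteratedDeriv_two_conv_kernel`,
`iteratedDeriv_two_conv_glue`). Up to a bounded term, (U * K)'' is therefore the jump of U at 0
times K', which is unbounded.

If u satisfies (B), this gives the claim for Lu at once, because M u has a bounded second derivative
near 0. If f satisfies (B), then u = (U * K - f) / M, with M > 0 by `kernel_integral_pos`. As U * K
is continuous, u inherits a jump from f; the regularity of u has to be bootstrapped. From U in L² it
follows that U * K has an L² derivative on Ω, so that u is piecewise a primitive. A second pass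
shows that its density is bounded near those of ±δ that lie in Ω, as the translates h(· ± δ)
require. -/

/-! ### Primitives, convolutions and sums of translates -/

/-- The primitive of `h` that vanishes at `-∞`. -/
noncomputable def primitive (h : ℝ → ℝ) (x : ℝ) : ℝ := ∫ t in Iic x, h t

/-- The convolution of two functions on the line. -/
noncomputable def conv (f g : ℝ → ℝ) (x : ℝ) : ℝ := ∫ y, f y * g (x - y)

/-- The linear combination of translates of `g` with coefficients `c`. -/
noncomputable def transSum (c : ℝ →₀ ℝ) (g : ℝ → ℝ) (t : ℝ) : ℝ := c.sum fun p a => a * g (t - p)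

/-- The unit step at the origin. -/
noncomputable def unitStep : ℝ → ℝ := indicator (Ici 0) 1

/-- `U` is almost everywhere a function with jumps `c p` at the points `p` and with the integrable
density `h` otherwise. -/
structure IsPrim (c : ℝ →₀ ℝ) (h U : ℝ → ℝ) : Prop where
  integrable : Integrable h
  ae_eq : U =ᵐ[volume] fun x => transSum c unitStep x + primitive h x

/-! ### Elementary rules for convolutions and sums of translates. -/

lemma conv_comm (f g : ℝ → ℝ) : conv f g = conv g f := by
  ext x
  unfold conv
  rw [← integral_sub_left_eq_self (fun y => f y * g (x - y)) volume x]
  simp [mul_comm]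

lemma conv_congr {f f' : ℝ → ℝ} (h : f =ᵐ[volume] f') (g : ℝ → ℝ) : conv f g = conv f' g := by
  ext x
  refine integral_congr_ae ?_
  filter_upwards [h] with y hy
  rw [hy]

lemma conv_integrable {f g : ℝ → ℝ} (hf : Integrable f) (hg : Integrable g) :
    Integrable (conv f g) := by
  have := hf.integrable_convolution (ContinuousLinearMap.mul ℝ ℝ) hg
  refine this.congr (Eventually.of_forall fun x => ?_)
  simp [convolution, conv]

lemma transSum_add (c d : ℝ →₀ ℝ) (g : ℝ → ℝ) (t : ℝ) :
    transSum (c + d) g t = transSum c g t + transSum d g t := by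
  unfold transSum
  rw [Finsupp.sum_add_index']
  · simp
  · intros; ring

lemma transSum_sub (c d : ℝ →₀ ℝ) (g : ℝ → ℝ) (t : ℝ) :
    transSum (c - d) g t = transSum c g t - transSum d g t := by
  unfold transSum
  rw [Finsupp.sum_sub_index]
  intros; ring

lemma transSum_single (p a : ℝ) (g : ℝ → ℝ) (t : ℝ) :
    transSum (Finsupp.single p a) g t = a * g (t - p) := by
  unfold transSum
  rw [Finsupp.sum_single_index]
  simp

lemma transSum_integrable (c : ℝ →₀ ℝ) {g : ℝ → ℝ} (hg : Integrable g) :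
    Integrable (transSum c g) := by
  unfold transSum Finsupp.sum
  exact integrable_finsetSum _ fun p _ => (hg.comp_sub_right p).const_mul _

/-! ### Primitives of integrable functions. -/

lemma primitive_add {f g : ℝ → ℝ} (hf : Integrable f) (hg : Integrable g) (x : ℝ) :
    primitive (fun t => f t + g t) x = primitive f x + primitive g x :=
  integral_add hf.integrableOn hg.integrableOn

lemma primitive_congr {f g : ℝ → ℝ} (h : f =ᵐ[volume] g) : primitive f = primitive g := by
  ext x
  exact integral_congr_ae (ae_restrict_of_ae h)

lemma primitive_sub_primitive {h : ℝ → ℝ} (hh : Integrable h) (a x : ℝ) :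
    primitive h x - primitive h a = ∫ t in a..x, h t :=
  intervalIntegral.integral_Iic_sub_Iic hh.integrableOn hh.integrableOn

lemma primitive_eq {h : ℝ → ℝ} (hh : Integrable h) (a x : ℝ) :
    primitive h x = primitive h a + ∫ t in a..x, h t := by
  rw [← primitive_sub_primitive hh]; ring

lemma continuous_primitive {h : ℝ → ℝ} (hh : Integrable h) : Continuous (primitive h) := by
  have : primitive h = fun x => primitive h 0 + ∫ t in (0:ℝ)..x, h t :=
    funext fun x => primitive_eq hh 0 x
  rw [this]
  exact continuous_const.add (intervalIntegral.continuous_primitive (fun a b => hh.intervalIntegrable) 0)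

lemma hasDerivAt_primitive {h : ℝ → ℝ} (hh : Integrable h) {x : ℝ} (hx : ContinuousAt h x) :
    HasDerivAt (primitive h) (h x) x := by
  have : primitive h = fun x => primitive h 0 + ∫ t in (0:ℝ)..x, h t :=
    funext fun x => primitive_eq hh 0 x
  rw [this]
  refine (intervalIntegral.integral_hasDerivAt_right hh.intervalIntegrable ?_ hx).const_add _
  exact hh.aestronglyMeasurable.stronglyMeasurableAtFilter

lemma abs_primitive_le {h : ℝ → ℝ} (hh : Integrable h) (x : ℝ) :
    |primitive h x| ≤ ∫ t, |h t| := by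
  refine (abs_integral_le_integral_abs).trans ?_
  exact setIntegral_le_integral hh.abs (Eventually.of_forall fun t => abs_nonneg _)

/-- Fubini's theorem on the half plane `s ≤ y`. -/
lemma integral_primitive_mul {h k : ℝ → ℝ} (hh : Integrable h) (hk : Integrable k) :
    ∫ y, primitive h y * k y = ∫ s, h s * ∫ y in Ici s, k y := by
  have hint : Integrable (Function.uncurry fun s y => (indicator {p : ℝ × ℝ | p.1 ≤ p.2}
      (fun p => h p.1 * k p.2)) (s, y)) (volume.prod volume) := by
    refine (hh.mul_prod hk).indicator ?_
    exact measurableSet_le measurable_fst measurable_snd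
  have hsw := integral_integral_swap hint
  have e1 : ∀ s, ∫ y, (indicator {p : ℝ × ℝ | p.1 ≤ p.2} (fun p => h p.1 * k p.2)) (s, y)
      = h s * ∫ y in Ici s, k y := by
    intro s
    rw [← integral_const_mul, ← integral_indicator measurableSet_Ici]
    refine integral_congr_ae (Eventually.of_forall fun y => ?_)
    simp [indicator]
  have e2 : ∀ y, ∫ s, (indicator {p : ℝ × ℝ | p.1 ≤ p.2} (fun p => h p.1 * k p.2)) (s, y)
      = primitive h y * k y := by
    intro y
    rw [primitive, ← integral_mul_const, ← integral_indicator measurableSet_Iic]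
    refine integral_congr_ae (Eventually.of_forall fun s => ?_)
    simp [indicator]
  simp only [e1, e2] at hsw
  exact hsw.symm

/-- The substitution y ↦ x + s - y carries [s, ∞) to (-∞, x]. -/
lemma setIntegral_Ici_comp_sub (g : ℝ → ℝ) (x s : ℝ) :
    ∫ y in Ici s, g (x - y) = primitive (fun t => g (t - s)) x := by
  rw [primitive, ← integral_indicator measurableSet_Ici, ← integral_indicator measurableSet_Iic,
    ← integral_sub_left_eq_self _ volume (x + s)]
  refine integral_congr_ae (Eventually.of_forall fun y => ?_)
  simp only [indicator, mem_Ici, mem_Iic]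
  have : s ≤ x + s - y ↔ y ≤ x := by constructor <;> intro <;> linarith
  simp only [this]
  congr 2
  ring

/-- Convolution commutes with translation, hence with integration from -∞; in practice, two
applications of Fubini's theorem. -/
lemma conv_primitive {h g : ℝ → ℝ} (hh : Integrable h) (hg : Integrable g) (x : ℝ) :
    conv (primitive h) g x = primitive (conv h g) x := by
  rw [conv, integral_primitive_mul hh (hg.comp_sub_left x)]
  simp only [setIntegral_Ici_comp_sub, primitive, conv]
  simp only [← integral_const_mul]
  rw [integral_integral_swap]
  have := (hh.convolution_integrand (ContinuousLinearMap.mul ℝ ℝ) hg).swap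
  exact this.mono_measure (Measure.prod_mono le_rfl Measure.restrict_le_self)

lemma unitStep_mul_integrable {g : ℝ → ℝ} (hg : Integrable g) (p x : ℝ) :
    Integrable fun y => unitStep (y - p) * g (x - y) := by
  have : (fun y => unitStep (y - p) * g (x - y)) = indicator (Ici p) (fun y => g (x - y)) := by
    ext y
    simp [unitStep, indicator]
  rw [this]
  exact (hg.comp_sub_left x).indicator measurableSet_Ici

/-- The derivative of a step at p is a point mass at p, and convolving that with g translates g by
p. -/
lemma conv_transSum_unitStep (c : ℝ →₀ ℝ) {g : ℝ → ℝ} (hg : Integrable g) (x : ℝ) :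
    conv (transSum c unitStep) g x = primitive (transSum c g) x := by
  unfold conv primitive transSum Finsupp.sum
  simp only [Finset.sum_mul]
  rw [integral_finsetSum, integral_finsetSum]
  · refine Finset.sum_congr rfl fun p _ => ?_
    simp only [mul_assoc]
    rw [integral_const_mul, integral_const_mul]
    congr 1
    have := setIntegral_Ici_comp_sub g x p
    rw [primitive] at this
    rw [← this, ← integral_indicator measurableSet_Ici]
    refine integral_congr_ae (Eventually.of_forall fun y => ?_)
    simp [unitStep, indicator]
  · exact fun p _ => ((hg.comp_sub_right p).const_mul _).integrableOn
  · intro p _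
    simp only [mul_assoc]
    exact (unitStep_mul_integrable hg p x).const_mul _

/-- The convolution of a piecewise primitive function is a primitive. -/
lemma IsPrim.conv_eq {c : ℝ →₀ ℝ} {h U g : ℝ → ℝ} (hU : IsPrim c h U) (hg : Integrable g) :
    conv U g = primitive (fun t => transSum c g t + conv h g t) := by
  ext x
  rw [conv_congr hU.ae_eq, primitive_add (transSum_integrable c hg)
    (conv_integrable hU.integrable hg), ← conv_transSum_unitStep c hg,
    ← conv_primitive hU.integrable hg]
  unfold conv
  rw [← integral_add]
  · simp only [add_mul]
  · unfold transSum Finsupp.sum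
    simp only [Finset.sum_mul, mul_assoc]
    exact integrable_finsetSum _ fun p _ => (unitStep_mul_integrable hg p x).const_mul _
  · exact (hg.comp_sub_left x).bdd_mul (c := ∫ t, |h t|)
      (continuous_primitive hU.integrable).aestronglyMeasurable
      (Eventually.of_forall fun y => abs_primitive_le hU.integrable y)

lemma IsPrim.add {c d : ℝ →₀ ℝ} {h k U V : ℝ → ℝ} (hU : IsPrim c h U) (hV : IsPrim d k V) :
    IsPrim (c + d) (fun x => h x + k x) (fun x => U x + V x) := by
  refine ⟨hU.integrable.add hV.integrable, ?_⟩
  filter_upwards [hU.ae_eq, hV.ae_eq] with x h1 h2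
  rw [h1, h2, transSum_add, primitive_add hU.integrable hV.integrable]
  ring

lemma IsPrim.congr {c : ℝ →₀ ℝ} {h h' U U' : ℝ → ℝ} (hU : IsPrim c h U) (hh : h =ᵐ[volume] h')
    (hUU : U =ᵐ[volume] U') : IsPrim c h' U' := by
  refine ⟨hU.integrable.congr hh, ?_⟩
  rw [← primitive_congr hh]
  exact hUU.symm.trans hU.ae_eq

/-- A function that is a primitive on an interval, cut off outside of it. -/
lemma IsPrim.of_interval {α β C : ℝ} (hαβ : α < β) {h g : ℝ → ℝ} (hh : IntegrableOn h (Ioo α β))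
    (hg : ∀ᵐ x, x ∈ Ioo α β → g x = C + ∫ t in α..x, h t) :
    IsPrim (Finsupp.single α C - Finsupp.single β (C + ∫ t in α..β, h t))
      (indicator (Ioo α β) h) (indicator (Ioo α β) g) := by
  have hi := hh.integrable_indicator measurableSet_Ioo
  refine ⟨hi, ?_⟩
  have h0 : primitive (indicator (Ioo α β) h) α = 0 := by
    rw [primitive, setIntegral_indicator measurableSet_Ioo]
    have : Iic α ∩ Ioo α β = ∅ := by
      ext y; simp only [mem_inter_iff, mem_Iic, mem_Ioo, mem_empty_iff_false, iff_false]
      rintro ⟨h1, h2, _⟩; linarith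
    simp [this]
  have hmid : ∀ x ∈ Icc α β, primitive (indicator (Ioo α β) h) x = ∫ t in α..x, h t := by
    intro x hx
    rw [primitive_eq hi α, h0, zero_add, intervalIntegral.integral_of_le hx.1,
      intervalIntegral.integral_of_le hx.1, integral_Ioc_eq_integral_Ioo,
      integral_Ioc_eq_integral_Ioo]
    refine setIntegral_congr_fun measurableSet_Ioo fun y hy => ?_
    rw [indicator_of_mem (show y ∈ Ioo α β from ⟨hy.1, hy.2.trans_le hx.2⟩)]
  have hlo : ∀ x ≤ α, primitive (indicator (Ioo α β) h) x = 0 := by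
    intro x hx
    rw [primitive, setIntegral_indicator measurableSet_Ioo]
    have : Iic x ∩ Ioo α β = ∅ := by
      ext y; simp only [mem_inter_iff, mem_Iic, mem_Ioo, mem_empty_iff_false, iff_false]
      rintro ⟨h1, h2, _⟩; linarith
    simp [this]
  have hhi : ∀ x, β ≤ x → primitive (indicator (Ioo α β) h) x = ∫ t in α..β, h t := by
    intro x hx
    rw [primitive, setIntegral_indicator measurableSet_Ioo]
    have : Iic x ∩ Ioo α β = Ioo α β := by
      ext y; simp only [mem_inter_iff, mem_Iic, mem_Ioo, and_iff_right_iff_imp]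
      rintro ⟨h1, h2⟩; linarith
    rw [this, intervalIntegral.integral_of_le hαβ.le, integral_Ioc_eq_integral_Ioo]
  -- At α the closed step already equals 1 while the open cut-off still vanishes. At β both sides
  -- vanish, so β needs no exception.
  have hne : ∀ᵐ x : ℝ, x ≠ α := by simp [ae_iff]
  filter_upwards [hg, hne] with x hx hxα
  rw [transSum_sub, transSum_single, transSum_single]
  simp only [unitStep, indicator_apply, mem_Ici, sub_nonneg, Pi.one_apply]
  by_cases h1 : x ≤ α
  · have h2 : ¬ α ≤ x := fun h => hxα (le_antisymm h1 h)
    have h3 : ¬ β ≤ x := by linarith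
    have h4 : x ∉ Ioo α β := fun h => h2 h.1.le
    simp [h2, h3, h4, hlo x h1]
  · push Not at h1
    by_cases h2 : β ≤ x
    · have h4 : x ∉ Ioo α β := fun h => absurd h.2 (not_lt.2 h2)
      rw [hhi x h2]
      simp [h1.le, h2, h4]
    · push Not at h2
      have h4 : x ∈ Ioo α β := ⟨h1, h2⟩
      rw [hmid x ⟨h1.le, h2.le⟩]
      simp [h1.le, h2.not_ge, h4, hx h4]

/-! ### Convolution of square integrable functions -/

lemma conv_integrand_integrable {f g : ℝ → ℝ} (hf : MemLp f 2 volume) (hg : MemLp g 2 volume)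
    (x : ℝ) : Integrable fun y => f y * g (x - y) :=
  hf.integrable_mul (hg.comp_measurePreserving (Measure.measurePreserving_sub_left volume x))

/-- The convolution of two square integrable functions is continuous. -/
lemma continuous_conv {f g : ℝ → ℝ} (hf : MemLp f 2 volume) (hg : MemLp g 2 volume) :
    Continuous (conv f g) := by
  -- The convolution at x is the L² inner product of f with the reflection of g translated by x, and
  -- translation acts continuously on L².
  have hg' : MemLp (fun y => g (-y)) 2 volume :=
    hg.comp_measurePreserving (Measure.measurePreserving_neg volume)
  have : Fact ((2 : ENNReal) ≠ ⊤) := ⟨by simp⟩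
  have hcont : Continuous fun x : ℝ =>
      inner ℝ (hf.toLp f) (DomAddAct.mk (-x) +ᵥ hg'.toLp (fun y => g (-y))) := by
    refine Continuous.inner continuous_const ?_
    have : Continuous fun x : ℝ => DomAddAct.mk (-x) := by fun_prop
    exact this.vadd continuous_const
  convert hcont using 1
  ext x
  rw [L2.inner_def]
  refine integral_congr_ae ?_
  have h1 := hf.coeFn_toLp
  have h2 := DomAddAct.vadd_Lp_ae_eq (DomAddAct.mk (-x)) (hg'.toLp (fun y => g (-y)))
  have h3 := (measurePreserving_add_left volume (-x)).quasiMeasurePreserving.ae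
    hg'.coeFn_toLp
  filter_upwards [h1, h2, h3] with y e1 e2 e3
  rw [e1, e2]
  change _ = inner ℝ (f y) ((hg'.toLp (fun y => g (-y)) : ℝ → ℝ) (-x + y))
  rw [e3]
  simp [mul_comm, sub_eq_add_neg, add_comm]

/-! ### Weak derivatives on an interval -/

lemma IsCompact.exists_Icc_subset_Ioo {α β : ℝ} (hαβ : α < β) {s : Set ℝ} (hs : IsCompact s)
    (hsub : s ⊆ Ioo α β) : ∃ a b, s ⊆ Icc a b ∧ Icc a b ⊆ Ioo α β := by
  rcases s.eq_empty_or_nonempty with rfl | hne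
  · exact ⟨(α + β) / 2, (α + β) / 2, by simp, by
      intro x hx; constructor <;> linarith [hx.1, hx.2]⟩
  · refine ⟨sInf s, sSup s, fun x hx => ⟨csInf_le hs.bddBelow hx, le_csSup hs.bddAbove hx⟩, ?_⟩
    intro x hx
    exact ⟨(hsub (hs.sInf_mem hne)).1.trans_le hx.1, hx.2.trans_lt (hsub (hs.sSup_mem hne)).2⟩

/-- A test function of vanishing integral is the derivative of a test function. -/
lemma exists_testFunction_deriv_eq {α β : ℝ} (hαβ : α < β) {ρ : ℝ → ℝ} (hρ : ContDiff ℝ ∞ ρ)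
    (hc : HasCompactSupport ρ) (hs : tsupport ρ ⊆ Ioo α β) (h0 : ∫ x, ρ x = 0) :
    ∃ φ : ℝ → ℝ, ContDiff ℝ ∞ φ ∧ HasCompactSupport φ ∧ tsupport φ ⊆ Ioo α β ∧ deriv φ = ρ := by
  -- The primitive of ρ need not vanish in gaps of the support of ρ, so its support is controlled
  -- only by a compact interval.
  obtain ⟨a, b, hab, hab'⟩ := hc.isCompact.exists_Icc_subset_Ioo hαβ hs
  have hint : Integrable ρ := hρ.continuous.integrable_of_hasCompactSupport hc
  have hd : ∀ x, HasDerivAt (primitive ρ) (ρ x) x := fun x =>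
    hasDerivAt_primitive hint hρ.continuous.continuousAt
  have hderiv : deriv (primitive ρ) = ρ := funext fun x => (hd x).deriv
  have hz : ∀ x, x ∉ Icc a b → ρ x = 0 := fun x hx =>
    image_eq_zero_of_notMem_tsupport fun h => hx (hab h)
  have hsupp : Function.support (primitive ρ) ⊆ Icc a b := by
    intro x hx
    by_contra hcon
    apply hx
    by_cases h1 : x < a
    · refine setIntegral_eq_zero_of_forall_eq_zero fun t ht => hz t fun h => ?_
      linarith [h.1, show t ≤ x from ht]
    · have h2 : b < x := by
        by_contra h3
        exact hcon ⟨not_lt.1 h1, not_lt.1 h3⟩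
      rw [primitive, setIntegral_eq_integral_of_forall_compl_eq_zero, h0]
      intro t ht
      refine hz t fun h => ht ?_
      exact h.2.trans h2.le
  have hts : tsupport (primitive ρ) ⊆ Icc a b := closure_minimal hsupp isClosed_Icc
  refine ⟨primitive ρ, ?_, ?_, hts.trans hab', hderiv⟩
  · rw [contDiff_infty_iff_deriv, hderiv]
    exact ⟨fun x => (hd x).differentiableAt, hρ⟩
  · exact isCompact_Icc.of_isClosed_subset (isClosed_tsupport _) hts

/-- The lemma of du Bois-Reymond. -/
lemma ae_eq_const_of_integral_mul_deriv_eq_zero {α β : ℝ} (hαβ : α < β) {G : ℝ → ℝ}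
    (hG : IntegrableOn G (Ioo α β))
    (h : ∀ φ : ℝ → ℝ, ContDiff ℝ ∞ φ → HasCompactSupport φ → tsupport φ ⊆ Ioo α β →
      ∫ x in Ioo α β, G x * deriv φ x = 0) :
    ∃ C, ∀ᵐ x, x ∈ Ioo α β → G x = C := by
  -- The outer radius is less than half the length of the interval, which keeps the closed support
  -- inside.
  let f : ContDiffBump ((α + β) / 2) := ⟨(β - α) / 6, (β - α) / 3, by linarith, by linarith⟩
  set η := f.normed volume with hη
  have hη1 : ContDiff ℝ ∞ η := f.contDiff_normed
  have hη2 : HasCompactSupport η := f.hasCompactSupport_normed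
  have hη3 : tsupport η ⊆ Ioo α β := by
    rw [hη, f.tsupport_normed_eq, Real.closedBall_eq_Icc]
    intro x hx
    have e : f.rOut = (β - α) / 3 := rfl
    rw [e] at hx
    constructor <;> linarith [hx.1, hx.2]
  have hη4 : ∫ x, η x = 1 := f.integral_normed
  have hηi : Integrable η := hη1.continuous.integrable_of_hasCompactSupport hη2
  have hmul : ∀ {k : ℝ → ℝ}, Continuous k → HasCompactSupport k →
      Integrable (fun x => G x * k x) (volume.restrict (Ioo α β)) := by
    intro k hk hkc
    obtain ⟨M, hM⟩ := hk.bounded_above_of_compact_support hkc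
    exact Integrable.mul_bdd (c := M) hG hk.aestronglyMeasurable (Eventually.of_forall hM)
  refine ⟨∫ x in Ioo α β, G x * η x, ?_⟩
  set C := ∫ x in Ioo α β, G x * η x with hC
  have key := isOpen_Ioo.ae_eq_zero_of_integral_contDiff_smul_eq_zero (μ := volume)
    (f := fun x => G x - C) (U := Ioo α β)
    (hG.locallyIntegrableOn.sub (locallyIntegrableOn_const C)) ?_
  · filter_upwards [key] with x hx hxI
    linarith [hx hxI]
  intro ψ hψ1 hψ2 hψ3
  have hψi : Integrable ψ := hψ1.continuous.integrable_of_hasCompactSupport hψ2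
  -- Since η has integral 1, subtracting (∫ ψ) η from ψ leaves a function of mean zero, hence the
  -- derivative of a test function.
  obtain ⟨φ, hφ1, hφ2, hφ3, hφ4⟩ := exists_testFunction_deriv_eq hαβ
    (ρ := fun x => ψ x - (∫ t, ψ t) * η x) (hψ1.sub (contDiff_const.mul hη1))
    (hψ2.sub hη2.mul_left)
    ((tsupport_sub _ _).trans (union_subset hψ3 ((tsupport_mul_subset_right).trans hη3)))
    (by rw [integral_sub hψi (hηi.const_mul _), integral_const_mul, hη4]; ring)
  have := h φ hφ1 hφ2 hφ3
  rw [hφ4] at this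
  have e : ∀ x, G x * (ψ x - (∫ t, ψ t) * η x) = G x * ψ x - (∫ t, ψ t) * (G x * η x) := by
    intro x; ring
  simp only [e] at this
  rw [integral_sub (hmul hψ1.continuous hψ2) ((hmul hη1.continuous hη2).const_mul _),
    integral_const_mul, ← hC] at this
  have hz : ∀ x, x ∉ Ioo α β → ψ x = 0 := fun x hx =>
    image_eq_zero_of_notMem_tsupport fun h => hx (hψ3 h)
  rw [← setIntegral_eq_integral_of_forall_compl_eq_zero (s := Ioo α β)
    (fun x hx => by simp [hz x hx])]
  have e2 : ∀ x, ψ x • (G x - C) = G x * ψ x - C * ψ x := by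
    intro x; simp only [smul_eq_mul]; ring
  simp only [e2]
  rw [integral_sub (hmul hψ1.continuous hψ2) (hψi.integrableOn.const_mul _), integral_const_mul,
    setIntegral_eq_integral_of_forall_compl_eq_zero hz]
  linarith

/-- A function in `W^{1,2}` is a primitive of a square integrable function on each interval. -/
lemma MemW12.exists_primitive {U : Set ℝ} {g : ℝ → ℝ} (hg : MemW12 U g) :
    ∃ h : ℝ → ℝ, MemLp h 2 (volume.restrict U) ∧ ∀ α β : ℝ, α < β → Ioo α β ⊆ U →
      ∃ C, ∀ᵐ x, x ∈ Ioo α β → g x = C + ∫ t in α..x, h t := by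
  obtain ⟨hgL, h, hhL, hweak⟩ := hg
  refine ⟨h, hhL, fun α β hαβ hU => ?_⟩
  have hhL' : MemLp h 2 (volume.restrict (Ioo α β)) :=
    hhL.mono_measure (Measure.restrict_mono_set _ hU)
  have hgL' : MemLp g 2 (volume.restrict (Ioo α β)) :=
    hgL.mono_measure (Measure.restrict_mono_set _ hU)
  have hhI : IntegrableOn h (Ioo α β) := hhL'.integrable (by norm_num)
  have hgI : IntegrableOn g (Ioo α β) := hgL'.integrable (by norm_num)
  set k := indicator (Ioo α β) h with hk
  have hkI : Integrable k := hhI.integrable_indicator measurableSet_Ioo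
  have hPc := continuous_primitive hkI
  have hPI : IntegrableOn (primitive k) (Ioo α β) :=
    hPc.integrableOn_Icc.mono_set Ioo_subset_Icc_self
  obtain ⟨C, hC⟩ := ae_eq_const_of_integral_mul_deriv_eq_zero hαβ (G := fun x => g x - primitive k x)
    (hgI.sub hPI) (by
      intro φ hφ1 hφ2 hφ3
      have hφ' : Continuous (deriv φ) := (hφ1.continuous_deriv (by simp))
      have hφ'c : HasCompactSupport (deriv φ) := hφ2.deriv
      have hz : ∀ x, x ∉ Ioo α β → φ x = 0 := fun x hx =>
        image_eq_zero_of_notMem_tsupport fun h => hx (hφ3 h)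
      have hz' : ∀ x, x ∉ Ioo α β → deriv φ x = 0 := fun x hx => by
        by_contra hne
        exact hx (hφ3 (support_deriv_subset hne))
      obtain ⟨M, hM⟩ := hφ'.bounded_above_of_compact_support hφ'c
      have hw := hweak φ hφ1 hφ2 (hφ3.trans (interior_maximal hU isOpen_Ioo))
      have hrestr : ∀ F : ℝ → ℝ, (∀ x, x ∉ Ioo α β → F x = 0) →
          ∫ x in U, F x = ∫ x in Ioo α β, F x := by
        intro F hF
        rw [setIntegral_eq_integral_of_forall_compl_eq_zero hF,
          setIntegral_eq_integral_of_forall_compl_eq_zero fun x hx => hF x fun h => hx (hU h)]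
      rw [hrestr _ fun x hx => by simp [hz' x hx], hrestr _ fun x hx => by simp [hz x hx]] at hw
      have hφ'I : Integrable (deriv φ) := hφ'.integrable_of_hasCompactSupport hφ'c
      -- Integration by parts through Fubini: the tail integral of φ' from s is -φ(s).
      have hP : ∫ x in Ioo α β, primitive k x * deriv φ x = - ∫ x in Ioo α β, h x * φ x := by
        rw [setIntegral_eq_integral_of_forall_compl_eq_zero fun x hx => by simp [hz' x hx],
          integral_primitive_mul hkI hφ'I, ← integral_neg, ← integral_indicator measurableSet_Ioo]
        refine integral_congr_ae (Eventually.of_forall fun s => ?_)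
        have : ∫ y in Ici s, deriv φ y = - φ s := by
          rw [integral_Ici_eq_integral_Ioi]
          exact hφ2.integral_Ioi_deriv_eq (hφ1.of_le (by simp)) s
        simp only [this, hk, indicator_apply]
        split_ifs <;> simp
      have e : ∀ x, (g x - primitive k x) * deriv φ x
          = g x * deriv φ x - primitive k x * deriv φ x := fun x => by ring
      simp only [e]
      rw [integral_sub, hw, hP, sub_self]
      · exact Integrable.mul_bdd (c := M) hgI hφ'.aestronglyMeasurable (Eventually.of_forall hM)
      · exact Integrable.mul_bdd (c := M) hPI hφ'.aestronglyMeasurable (Eventually.of_forall hM))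
  refine ⟨C + primitive k α, ?_⟩
  filter_upwards [hC] with x hx hxI
  have h1 := hx hxI
  have h2 := primitive_eq hkI α x
  have h3 : ∫ t in α..x, k t = ∫ t in α..x, h t := by
    rw [intervalIntegral.integral_of_le hxI.1.le, intervalIntegral.integral_of_le hxI.1.le]
    refine setIntegral_congr_fun measurableSet_Ioc fun y hy => ?_
    rw [hk, indicator_of_mem (show y ∈ Ioo α β from ⟨hy.1, hy.2.trans_lt hxI.2⟩)]
  linarith

/-! ### Functions that are continuous and bounded in a punctured neighbourhood -/

/-- `g` is continuous and bounded in a punctured neighbourhood of `p`. -/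
def Tame (g : ℝ → ℝ) (p : ℝ) : Prop := ∃ C, ∀ᶠ x in 𝓝[≠] p, ContinuousAt g x ∧ |g x| ≤ C

/-- The punctured line is open. This upgrades identities near p to identities of germs, which may be
differentiated. -/
lemma eventually_eventually_punctured {P : ℝ → Prop} {p : ℝ} (h : ∀ᶠ x in 𝓝[≠] p, P x) :
    ∀ᶠ x in 𝓝[≠] p, ∀ᶠ y in 𝓝 x, P y := by
  filter_upwards [eventually_eventually_nhdsWithin.2 h, self_mem_nhdsWithin] with x hx hxp
  rwa [isOpen_compl_singleton.nhdsWithin_eq hxp] at hx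

lemma Tame.congr {g k : ℝ → ℝ} {p : ℝ} (hg : Tame g p) (h : ∀ᶠ x in 𝓝[≠] p, g x = k x) :
    Tame k p := by
  obtain ⟨C, hC⟩ := hg
  refine ⟨C, ?_⟩
  filter_upwards [hC, eventually_eventually_punctured h] with x hx hy
  exact ⟨hx.1.congr hy, hy.self_of_nhds ▸ hx.2⟩

lemma Tame.add {g k : ℝ → ℝ} {p : ℝ} (hg : Tame g p) (hk : Tame k p) :
    Tame (fun x => g x + k x) p := by
  obtain ⟨C, hC⟩ := hg
  obtain ⟨D, hD⟩ := hk
  refine ⟨C + D, ?_⟩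
  filter_upwards [hC, hD] with x hx hy
  exact ⟨hx.1.add hy.1, (abs_add_le _ _).trans (add_le_add hx.2 hy.2)⟩

lemma Tame.const_mul {g : ℝ → ℝ} {p : ℝ} (hg : Tame g p) (a : ℝ) : Tame (fun x => a * g x) p := by
  obtain ⟨C, hC⟩ := hg
  refine ⟨|a| * C, ?_⟩
  filter_upwards [hC] with x hx
  refine ⟨continuousAt_const.mul hx.1, ?_⟩
  rw [abs_mul]
  exact mul_le_mul_of_nonneg_left hx.2 (abs_nonneg _)

lemma Tame.sum {ι : Type*} {s : Finset ι} {g : ι → ℝ → ℝ} {p : ℝ} (hg : ∀ i ∈ s, Tame (g i) p) :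
    Tame (fun x => ∑ i ∈ s, g i x) p := by
  classical
  induction s using Finset.induction_on with
  | empty => exact ⟨0, Eventually.of_forall fun x => by simp [continuousAt_const]⟩
  | insert i s hi ih =>
    simp only [Finset.sum_insert hi]
    exact (hg i (by simp)).add (ih fun j hj => hg j (by simp [hj]))

lemma tendsto_sub_punctured (p q : ℝ) : Tendsto (fun x => x - q) (𝓝[≠] p) (𝓝[≠] (p - q)) := by
  refine tendsto_nhdsWithin_iff.2 ⟨?_, ?_⟩
  · exact (tendsto_id.sub_const q).mono_left nhdsWithin_le_nhds
  · filter_upwards [self_mem_nhdsWithin] with x hx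
    simpa using hx

lemma Tame.comp_sub {g : ℝ → ℝ} {p q : ℝ} (hg : Tame g (p - q)) : Tame (fun x => g (x - q)) p := by
  obtain ⟨C, hC⟩ := hg
  refine ⟨C, ?_⟩
  filter_upwards [(tendsto_sub_punctured p q).eventually hC] with x hx
  exact ⟨ContinuousAt.comp (f := fun x => x - q) hx.1 (by fun_prop), hx.2⟩

lemma Tame.transSum {g : ℝ → ℝ} {p : ℝ} {c : ℝ →₀ ℝ} (hg : ∀ q ∈ c.support, Tame g (p - q)) :
    Tame (transSum c g) p :=
  Tame.sum fun q hq => (hg q hq).comp_sub.const_mul _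

lemma tame_of_eventually_continuousAt {g : ℝ → ℝ} {p : ℝ} (hg : ∀ᶠ x in 𝓝 p, ContinuousAt g x) :
    Tame g p := by
  refine ⟨|g p| + 1, ?_⟩
  have := hg.self_of_nhds.abs.eventually_lt_const (lt_add_one |g p|)
  filter_upwards [nhdsWithin_le_nhds hg, nhdsWithin_le_nhds this] with x h1 h2
  exact ⟨h1, h2.le⟩

lemma tame_of_continuous {g : ℝ → ℝ} (hg : Continuous g) (p : ℝ) : Tame g p :=
  tame_of_eventually_continuousAt (Eventually.of_forall fun _ => hg.continuousAt)

lemma tame_of_tendsto {g : ℝ → ℝ} {p l r : ℝ} (hg : ∀ᶠ x in 𝓝[≠] p, ContinuousAt g x)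
    (hl : Tendsto g (𝓝[<] p) (𝓝 l)) (hr : Tendsto g (𝓝[>] p) (𝓝 r)) : Tame g p := by
  refine ⟨max |l| |r| + 1, hg.and ?_⟩
  rw [← Iio_union_Ioi, nhdsWithin_union, eventually_sup]
  constructor
  · filter_upwards [hl.abs.eventually_lt_const (lt_add_one |l|)] with x hx
    linarith [le_max_left |l| |r|]
  · filter_upwards [hr.abs.eventually_lt_const (lt_add_one |r|)] with x hx
    linarith [le_max_right |l| |r|]

/-- A function with two successive derivatives given near a point. -/
lemma contDiffAt_two_of_hasDerivAt {w w' w'' : ℝ → ℝ} {x : ℝ}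
    (h1 : ∀ᶠ y in 𝓝 x, HasDerivAt w (w' y) y) (h2 : ∀ᶠ y in 𝓝 x, HasDerivAt w' (w'' y) y)
    (h3 : ∀ᶠ y in 𝓝 x, ContinuousAt w'' y) :
    ContDiffAt ℝ 2 w x ∧ iteratedDeriv 2 w x = w'' x := by
  have e1 : deriv w =ᶠ[𝓝 x] w' := h1.mono fun y hy => hy.deriv
  have e2 : deriv w' =ᶠ[𝓝 x] w'' := h2.mono fun y hy => hy.deriv
  constructor
  · obtain ⟨s, hs, hso, hxs⟩ := eventually_nhds_iff.1
      (h1.and (h2.and (h3.and (e1.eventuallyEq_nhds.and e2.eventuallyEq_nhds))))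
    have hc : ContDiffOn ℝ (1 + 1) w s := by
      rw [contDiffOn_succ_iff_deriv_of_isOpen hso]
      refine ⟨fun y hy => (hs y hy).1.differentiableAt.differentiableWithinAt, by simp, ?_⟩
      have hc' : ContDiffOn ℝ (0 + 1) w' s := by
        rw [contDiffOn_succ_iff_deriv_of_isOpen hso]
        refine ⟨fun y hy => (hs y hy).2.1.differentiableAt.differentiableWithinAt, by simp, ?_⟩
        rw [contDiffOn_zero]
        intro y hy
        exact ((hs y hy).2.2.1.congr (hs y hy).2.2.2.2.symm).continuousWithinAt
      rw [zero_add] at hc'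
      exact hc'.congr fun y hy => (hs y hy).2.2.2.1.self_of_nhds
    have := hc.contDiffAt (hso.mem_nhds hxs)
    rwa [one_add_one_eq_two] at this
  · rw [iteratedDeriv_succ, iteratedDeriv_one, e1.deriv_eq, e2.self_of_nhds]

/-! ### Functions given as primitives on an interval -/

/-- Cutting h off makes the primitive continuous on the whole line. The constant and the end value
thus become one-sided limits, and these determine the jump coefficients. -/
lemma tendsto_of_primitive {α β C : ℝ} (hαβ : α < β) {h g : ℝ → ℝ} (hh : IntegrableOn h (Ioo α β))
    (hg : ∀ x ∈ Ioo α β, g x = C + ∫ t in α..x, h t) :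
    Tendsto g (𝓝[>] α) (𝓝 C) ∧ Tendsto g (𝓝[<] β) (𝓝 (C + ∫ t in α..β, h t)) := by
  have hi := hh.integrable_indicator measurableSet_Ioo
  set k := indicator (Ioo α β) h with hk
  have hint : ∀ x ∈ Icc α β, ∫ t in α..x, k t = ∫ t in α..x, h t := by
    intro x hx
    rw [intervalIntegral.integral_of_le hx.1, intervalIntegral.integral_of_le hx.1,
      integral_Ioc_eq_integral_Ioo, integral_Ioc_eq_integral_Ioo]
    refine setIntegral_congr_fun measurableSet_Ioo fun y hy => ?_
    rw [hk, indicator_of_mem (show y ∈ Ioo α β from ⟨hy.1, hy.2.trans_le hx.2⟩)]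
  have hcont : Continuous fun x => C + ∫ t in α..x, k t :=
    continuous_const.add (intervalIntegral.continuous_primitive (fun a b => hi.intervalIntegrable) α)
  have heq : ∀ x ∈ Ioo α β, C + ∫ t in α..x, k t = g x := fun x hx => by
    rw [hg x hx, hint x ⟨hx.1.le, hx.2.le⟩]
  constructor
  · have := hcont.tendsto α
    simp only [intervalIntegral.integral_same, add_zero] at this
    refine (this.mono_left nhdsWithin_le_nhds).congr' ?_
    filter_upwards [Ioo_mem_nhdsGT hαβ] with x hx using heq x hx
  · have := hcont.tendsto β
    rw [hint β ⟨hαβ.le, le_rfl⟩] at this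
    refine (this.mono_left nhdsWithin_le_nhds).congr' ?_
    filter_upwards [Ioo_mem_nhdsLT hαβ] with x hx using heq x hx

/-- Nothing is known about f at the ends, so the fundamental theorem of calculus is applied from the
midpoint; integrability of f' up to the ends then moves the base point to α. -/
lemma exists_primitive_of_hasDerivAt {α β : ℝ} (hαβ : α < β) {f f' : ℝ → ℝ}
    (hf : ∀ x ∈ Ioo α β, HasDerivAt f (f' x) x)
    (hint : IntegrableOn f' (Ioo α β)) :
    ∃ C, ∀ x ∈ Ioo α β, f x = C + ∫ t in α..x, f' t := by
  have hii : ∀ x ∈ Icc α β, ∀ y ∈ Icc α β, IntervalIntegrable f' volume x y := by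
    intro x hx y hy
    rw [← integrableOn_Icc_iff_integrableOn_Ioo] at hint
    exact ((intervalIntegrable_iff_integrableOn_Icc_of_le hαβ.le).2 hint).mono_set (by
      rw [uIcc_of_le hαβ.le]; exact uIcc_subset_Icc hx hy)
  have hm : (α + β) / 2 ∈ Ioo α β := by constructor <;> linarith
  refine ⟨f ((α + β) / 2) - ∫ t in α..(α + β) / 2, f' t, fun x hx => ?_⟩
  have hα : α ∈ Icc α β := ⟨le_rfl, hαβ.le⟩
  have h1 := intervalIntegral.integral_add_adjacent_intervals
    (hii α hα _ (Ioo_subset_Icc_self hm)) (hii _ (Ioo_subset_Icc_self hm) x (Ioo_subset_Icc_self hx))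
  have h2 := intervalIntegral.integral_eq_sub_of_hasDerivAt (f := f) (f' := f')
    (a := (α + β) / 2) (b := x) (fun y hy => hf y (ordConnected_Ioo.uIcc_subset hm hx hy))
    (hii _ (Ioo_subset_Icc_self hm) x (Ioo_subset_Icc_self hx))
  linarith

lemma ContDiffOn.hasDerivAt_deriv {n : WithTop ℕ∞} {f : ℝ → ℝ} {s : Set ℝ} (hf : ContDiffOn ℝ n f s)
    (hn : n ≠ 0) (hs : IsOpen s) {x : ℝ} (hx : x ∈ s) : HasDerivAt f (deriv f x) x :=
  ((hf.contDiffAt (hs.mem_nhds hx)).differentiableAt hn).hasDerivAt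

/-! ### The kernel -/

section Kernel

variable {δ κ : ℝ} {K : ℝ → ℝ}

lemma kernel_contDiffAt (hA1 : AssumptionA1 δ K) (hA2 : AssumptionA2 δ K) {x : ℝ}
    (h0 : x ≠ 0) (h1 : x ≠ δ) (h2 : x ≠ -δ) : ContDiffAt ℝ ∞ K x := by
  by_cases hx : |x| < δ
  · rw [abs_lt] at hx
    rcases lt_or_gt_of_ne h0 with h | h
    · exact hA2.smooth_left.contDiffAt (Ioo_mem_nhds hx.1 h)
    · exact hA2.smooth_right.contDiffAt (Ioo_mem_nhds h hx.2)
  · have hx' : δ < |x| := by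
      refine lt_of_le_of_ne (not_lt.1 hx) fun h => ?_
      rcases abs_choice x with e | e <;> rw [e] at h
      · exact h1 h.symm
      · exact h2 (by linarith)
    have : K =ᶠ[𝓝 x] fun _ => 0 := by
      filter_upwards [continuousAt_id.abs.eventually_const_lt hx'] with y hy
      exact hA1.zero_of_le y hy.le
    exact contDiffAt_const.congr_of_eventuallyEq this

lemma eventually_ne_punctured (p q : ℝ) : ∀ᶠ x in 𝓝[≠] p, x ≠ q := by
  by_cases h : p = q
  · rw [h]; exact self_mem_nhdsWithin
  · exact nhdsWithin_le_nhds (isOpen_ne.mem_nhds h)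

lemma kernel_eventually_contDiffAt (hA1 : AssumptionA1 δ K) (hA2 : AssumptionA2 δ K) (p : ℝ) :
    ∀ᶠ x in 𝓝[≠] p, ContDiffAt ℝ ∞ K x := by
  filter_upwards [eventually_ne_punctured p 0, eventually_ne_punctured p δ,
    eventually_ne_punctured p (-δ)] with x h0 h1 h2
  exact kernel_contDiffAt hA1 hA2 h0 h1 h2

lemma deriv_kernel_neg (hA1 : AssumptionA1 δ K) (x : ℝ) : deriv K (-x) = -deriv K x := by
  have h : (fun y => K (-y)) = K := funext hA1.radial
  have := deriv_comp_neg K x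
  rw [h] at this
  linarith

lemma deriv_kernel_eq_zero (hA1 : AssumptionA1 δ K) {x : ℝ} (hx : δ < |x|) : deriv K x = 0 := by
  have : K =ᶠ[𝓝 x] fun _ => 0 := by
    filter_upwards [continuousAt_id.abs.eventually_const_lt hx] with y hy
    exact hA1.zero_of_le y hy.le
  rw [this.deriv_eq]
  simp

lemma eq_indicator_of_eq_zero {g : ℝ → ℝ} (hg : ∀ x, δ < |x| → g x = 0) :
    g = indicator (Icc (-δ) δ) g := by
  ext x
  by_cases hx : x ∈ Icc (-δ) δ
  · rw [indicator_of_mem hx]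
  · rw [indicator_of_notMem hx]
    exact hg x (by by_contra h; exact hx (abs_le.1 (not_lt.1 h)))

lemma kernel_memLp_two (hA1 : AssumptionA1 δ K) (hK : MemLp K ⊤ volume) : MemLp K 2 volume := by
  rw [eq_indicator_of_eq_zero fun x hx => hA1.zero_of_le x hx.le,
    memLp_indicator_iff_restrict measurableSet_Icc]
  exact (hK.restrict _).mono_exponent le_top

lemma deriv_kernel_integrable (hA1 : AssumptionA1 δ K) (hK' : MemLp (deriv K) 2 volume) :
    Integrable (deriv K) := by
  rw [eq_indicator_of_eq_zero (g := deriv K) fun x hx => deriv_kernel_eq_zero hA1 hx,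
    integrable_indicator_iff measurableSet_Icc]
  exact (hK'.restrict _).integrable (by norm_num)

lemma tendsto_neg_iff_of_even {g : ℝ → ℝ} (hg : ∀ x, g (-x) = g x) {p l : ℝ} :
    Tendsto g (𝓝[>] (-p)) (𝓝 l) ↔ Tendsto g (𝓝[<] p) (𝓝 l) := by
  have h : (fun x => g (-x)) = g := funext hg
  constructor
  · intro H
    have : Tendsto (fun x : ℝ => -x) (𝓝[<] p) (𝓝[>] (-p)) := tendsto_neg_nhdsLT
    have := H.comp this
    rwa [Function.comp_def, h] at this
  · intro H
    have : Tendsto (fun x : ℝ => -x) (𝓝[>] (-p)) (𝓝[<] p) := tendsto_neg_nhdsGT_neg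
    have := H.comp this
    rwa [Function.comp_def, h] at this

/-- The kernel is a primitive of its derivative, up to its jumps at `±δ`. -/
lemma kernel_isPrim (hδ : 0 < δ) (hA1 : AssumptionA1 δ K) (hA2 : AssumptionA2 δ K)
    (hK' : MemLp (deriv K) 2 volume) (hκ : Tendsto K (𝓝[<] δ) (𝓝 κ)) :
    IsPrim (Finsupp.single (-δ) κ - Finsupp.single δ κ) (deriv K) K ∧
      ∃ l, Tendsto K (𝓝[<] 0) (𝓝 l) ∧ Tendsto K (𝓝[>] 0) (𝓝 l) := by
  have hI := deriv_kernel_integrable hA1 hK'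
  have hδ' : -δ < 0 := by linarith
  obtain ⟨D, hD⟩ := exists_primitive_of_hasDerivAt hδ'
    (fun x hx => hA2.smooth_left.hasDerivAt_deriv (by simp) isOpen_Ioo hx) hI.integrableOn
  obtain ⟨C, hC⟩ := exists_primitive_of_hasDerivAt hδ
    (fun x hx => hA2.smooth_right.hasDerivAt_deriv (by simp) isOpen_Ioo hx) hI.integrableOn
  obtain ⟨tD, tD'⟩ := tendsto_of_primitive hδ' hI.integrableOn hD
  obtain ⟨tC, tC'⟩ := tendsto_of_primitive hδ hI.integrableOn hC
  have e1 := tendsto_nhds_unique tC' hκ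
  have e2 := tendsto_nhds_unique ((tendsto_neg_iff_of_even hA1.radial).1 tD) hκ
  -- Evenness makes the one-sided limits at 0 agree, so the two step coefficients at 0 cancel and
  -- only the jumps at ±δ survive.
  have e3 : D + ∫ t in (-δ)..0, deriv K t = C := by
    have := (tendsto_neg_iff_of_even hA1.radial (p := 0) (l := C)).1 (by simpa using tC)
    exact tendsto_nhds_unique tD' this
  have hp := (IsPrim.of_interval hδ' hI.integrableOn (Eventually.of_forall hD)).add
    (IsPrim.of_interval hδ hI.integrableOn (Eventually.of_forall hC))
  rw [e1, e3, e2, sub_add_sub_cancel] at hp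
  have hsplit : ∀ g : ℝ → ℝ, (∀ x, δ < |x| → g x = 0) →
      (fun x => indicator (Ioo (-δ) 0) g x + indicator (Ioo 0 δ) g x) =ᵐ[volume] g := by
    intro g hg
    have h0 : ∀ᵐ x : ℝ, x ≠ 0 := by simp [ae_iff]
    have h1 : ∀ᵐ x : ℝ, x ≠ δ := by simp [ae_iff]
    have h2 : ∀ᵐ x : ℝ, x ≠ -δ := by simp [ae_iff]
    filter_upwards [h0, h1, h2] with x h0 h1 h2
    by_cases hx : δ < |x|
    · simp [indicator_apply, hg x hx]
    · obtain ⟨ha, hb⟩ := abs_le.1 (not_lt.1 hx)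
      have ha' := lt_of_le_of_ne ha h2.symm
      have hb' := lt_of_le_of_ne hb h1
      rcases lt_or_gt_of_ne h0 with h | h
      · simp [ha', h, h.not_gt]
      · simp [hb', h, h.not_gt]
  refine ⟨hp.congr (hsplit _ fun x hx => deriv_kernel_eq_zero hA1 hx)
    (hsplit _ fun x hx => hA1.zero_of_le x hx.le), C, ?_, tC⟩
  rwa [e3] at tD'

/-- Only 0 and ±δ are critical, and there both one-sided limits exist: at 0 because K' is
integrable, at ±δ by (A2) from inside and because K vanishes outside. -/
lemma kernel_tame (hδ : 0 < δ) (hA1 : AssumptionA1 δ K) (hA2 : AssumptionA2 δ K)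
    (hK' : MemLp (deriv K) 2 volume) (p : ℝ) : Tame K p := by
  obtain ⟨κ, hκ⟩ := hA2.limit_right
  obtain ⟨-, l, hl, hr⟩ := kernel_isPrim hδ hA1 hA2 hK' hκ
  have hev : ∀ᶠ x in 𝓝[≠] p, ContinuousAt K x :=
    (kernel_eventually_contDiffAt hA1 hA2 p).mono fun x hx => hx.continuousAt
  have hright : Tendsto K (𝓝[>] δ) (𝓝 0) := by
    refine tendsto_const_nhds.congr' ?_
    filter_upwards [self_mem_nhdsWithin] with x hx
    exact (hA1.zero_of_le x ((show δ < x from hx).le.trans (le_abs_self x))).symm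
  by_cases h0 : p = 0
  · subst h0; exact tame_of_tendsto hev hl hr
  by_cases h1 : p = δ
  · subst h1; exact tame_of_tendsto hev hκ hright
  by_cases h2 : p = -δ
  · subst h2
    refine tame_of_tendsto hev (l := 0) (r := κ) ?_ ((tendsto_neg_iff_of_even hA1.radial).2 hκ)
    rw [← tendsto_neg_iff_of_even hA1.radial, neg_neg]
    exact hright
  · refine tame_of_eventually_continuousAt ?_
    exact ((kernel_contDiffAt hA1 hA2 h0 h1 h2).of_le (m := 0) (by simp)).eventually (by simp)
      |>.mono fun x hx => hx.continuousAt

lemma ContDiffAt.continuousAt_deriv_infty {g : ℝ → ℝ} {x : ℝ} (hg : ContDiffAt ℝ ∞ g x) :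
    ContinuousAt (deriv g) x := by
  exact (hg.fderiv_right (m := 0) (by simp)).continuousAt.clm_apply continuousAt_const

/-- Away from 0 and ±δ the kernel is smooth. At δ the derivative is bounded inside by assumption and
zero outside; oddness of K' carries this to -δ. -/
lemma deriv_kernel_tame (hδ : 0 < δ) (hA1 : AssumptionA1 δ K) (hA2 : AssumptionA2 δ K) {p : ℝ}
    (h0 : p ≠ 0) (hp : |p| = δ → ∃ C : ℝ, ∀ᶠ x in 𝓝[<] δ, |deriv K x| ≤ C) :
    Tame (deriv K) p := by
  by_cases h1 : |p| = δ
  · obtain ⟨C, hC⟩ := hp h1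
    have hC' : ∀ᶠ x in 𝓝[≠] δ, |deriv K x| ≤ max C 0 := by
      rw [← Iio_union_Ioi, nhdsWithin_union, eventually_sup]
      refine ⟨hC.mono fun x hx => hx.trans (le_max_left _ _), ?_⟩
      filter_upwards [self_mem_nhdsWithin] with x hx
      rw [deriv_kernel_eq_zero hA1 ((show δ < x from hx).trans_le (le_abs_self x))]
      simp
    have hcont : ∀ᶠ x in 𝓝[≠] p, ContinuousAt (deriv K) x :=
      (kernel_eventually_contDiffAt hA1 hA2 p).mono fun x hx => hx.continuousAt_deriv_infty
    refine ⟨max C 0, hcont.and ?_⟩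
    rcases abs_choice p with e | e
    · rwa [show p = δ by linarith]
    · have hneg : Tendsto (fun x : ℝ => -x) (𝓝[≠] p) (𝓝[≠] δ) := by
        refine tendsto_nhdsWithin_iff.2 ⟨?_, ?_⟩
        · rw [show δ = -p by linarith]
          exact tendsto_neg p |>.mono_left nhdsWithin_le_nhds
        · filter_upwards [self_mem_nhdsWithin] with x hx h
          exact hx (show x = p by rw [mem_singleton_iff] at h; linarith)
      filter_upwards [hneg.eventually hC'] with x hx
      rwa [deriv_kernel_neg hA1, abs_neg] at hx
  · have h2 : p ≠ δ := by rintro rfl; exact h1 (abs_of_pos hδ)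
    have h3 : p ≠ -δ := by rintro rfl; exact h1 (by rw [abs_neg, abs_of_pos hδ])
    have hnhd : ∀ᶠ x in 𝓝 p, x ≠ 0 ∧ x ≠ δ ∧ x ≠ -δ :=
      (eventually_ne_nhds h0).and ((eventually_ne_nhds h2).and (eventually_ne_nhds h3))
    exact tame_of_eventually_continuousAt (hnhd.mono fun x hx =>
      (kernel_contDiffAt hA1 hA2 hx.1 hx.2.1 hx.2.2).continuousAt_deriv_infty)

/-- The total mass of the kernel is positive. -/
lemma kernel_integral_pos (hδ : 0 < δ) (hA1 : AssumptionA1 δ K) (hA2 : AssumptionA2 δ K)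
    (hK'sing : UnboundedAtZero (deriv K)) : 0 < ∫ x, K x := by
  obtain ⟨x, hx, hx0, hxδ⟩ : ∃ x, 0 < |deriv K x| ∧ 0 < x ∧ x < δ := by
    have := (hK'sing.1 0).and_eventually (Ioo_mem_nhdsGT hδ)
    obtain ⟨x, hx⟩ := this.exists
    exact ⟨x, hx.1, hx.2.1, hx.2.2⟩
  by_contra hcon
  have h0 : ∫ x, K x = 0 := le_antisymm (not_lt.1 hcon) (integral_nonneg hA1.nonneg)
  rw [integral_eq_zero_iff_of_nonneg hA1.nonneg hA1.integrable] at h0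
  have hz : EqOn K (fun _ => 0) (Ioo 0 δ) :=
    -- A kernel of zero mass vanishes almost everywhere, hence by continuity everywhere on (0, δ),
    -- against the unboundedness of K'.
    Measure.eqOn_open_of_ae_eq (ae_restrict_of_ae h0) isOpen_Ioo
      hA2.smooth_right.continuousOn continuousOn_const
  have : K =ᶠ[𝓝 x] fun _ => 0 := hz.eventuallyEq_of_mem (Ioo_mem_nhds hx0 hxδ)
  rw [this.deriv_eq] at hx
  simp at hx

/-- The primitive representation of a convolution with the kernel. -/
lemma conv_kernel_eq (hδ : 0 < δ) (hA1 : AssumptionA1 δ K) (hA2 : AssumptionA2 δ K)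
    (hK' : MemLp (deriv K) 2 volume) (hκ : Tendsto K (𝓝[<] δ) (𝓝 κ)) {g : ℝ → ℝ}
    (hg : Integrable g) :
    conv g K = primitive
      (fun t => transSum (Finsupp.single (-δ) κ - Finsupp.single δ κ) g t + conv (deriv K) g t) := by
  -- Here K plays the part of the piecewise primitive, so that no derivative of g is needed.
  rw [conv_comm, (kernel_isPrim hδ hA1 hA2 hK' hκ).1.conv_eq hg]

/-- The second derivative at the origin of the convolution of the kernel with a function that has a
jump at the origin. -/
lemma iteratedDeriv_two_conv_kernel (hδ : 0 < δ) (hA1 : AssumptionA1 δ K) (hA2 : AssumptionA2 δ K)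
    (hK' : MemLp (deriv K) 2 volume) (hκ : Tendsto K (𝓝[<] δ) (𝓝 κ))
    {c : ℝ →₀ ℝ} {h U : ℝ → ℝ} (hU : IsPrim c h U) (hh : MemLp h 2 volume)
    (hc : ∀ p ∈ c.support, p ≠ 0 → |p| = δ → ∃ C : ℝ, ∀ᶠ x in 𝓝[<] δ, |deriv K x| ≤ C)
    (hκh : κ ≠ 0 → Tame h δ ∧ Tame h (-δ)) :
    ∃ R, Tame R 0 ∧ ∀ᶠ x in 𝓝[≠] 0,
      ContDiffAt ℝ 2 (conv U K) x ∧ iteratedDeriv 2 (conv U K) x = c 0 * deriv K x + R x := by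
  set cK := Finsupp.single (-δ) κ - Finsupp.single δ κ with hcK
  set W1 := fun t => transSum c K t + conv h K t with hW1
  set G2 := fun t => transSum cK h t + conv (deriv K) h t with hG2
  -- The first derivative is taken on U; in the remaining term h * K the second is taken on K.
  have hw : conv U K = primitive W1 := hU.conv_eq hA1.integrable
  have hG2' : conv h K = primitive G2 := conv_kernel_eq hδ hA1 hA2 hK' hκ hU.integrable
  have hW1i : Integrable W1 :=
    (transSum_integrable c hA1.integrable).add (conv_integrable hU.integrable hA1.integrable)
  have hKi := deriv_kernel_integrable hA1 hK'
  have hG2i : Integrable G2 :=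
    (transSum_integrable cK hU.integrable).add (conv_integrable hKi hU.integrable)
  -- K' * h is continuous, so only the translates of h by ±δ need attention, and only if K jumps
  -- there.
  have hG2t : Tame G2 0 := by
    refine Tame.add ?_ (tame_of_continuous (continuous_conv hK' hh) 0)
    have e : transSum cK h = fun x => κ * h (x - -δ) + (-κ) * h (x - δ) := by
      ext x; rw [hcK, transSum_sub, transSum_single, transSum_single]; ring
    rw [e]
    by_cases hκ0 : κ = 0
    · simp only [hκ0, zero_mul, neg_zero, add_zero]
      exact tame_of_continuous continuous_const 0
    · obtain ⟨t1, t2⟩ := hκh hκ0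
      exact (Tame.comp_sub (by simpa using t1)).const_mul _ |>.add
        ((Tame.comp_sub (by simpa using t2)).const_mul _)
  set R := fun x => (c.erase 0).sum (fun p a => a * deriv K (x - p)) + G2 x with hR
  have hRt : Tame R 0 := by
    refine Tame.add (Tame.transSum (c := c.erase 0) fun q hq => ?_) hG2t
    rw [Finsupp.support_erase, Finset.mem_erase] at hq
    refine deriv_kernel_tame hδ hA1 hA2 (by simpa using hq.1) fun hq' => hc q hq.2 hq.1 ?_
    simpa using hq'
  have hsum : ∀ x, c.sum (fun p a => a * deriv K (x - p)) =
      c 0 * deriv K x + (c.erase 0).sum (fun p a => a * deriv K (x - p)) := by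
    intro x
    have e := transSum_add (Finsupp.single 0 (c 0)) (c.erase 0) (deriv K) x
    rw [Finsupp.single_add_erase, transSum_single, sub_zero] at e
    exact e
  have hKev : ∀ p ∈ c.support, ∀ᶠ x in 𝓝[≠] (0 : ℝ), ContDiffAt ℝ ∞ K (x - p) := fun p _ =>
    (tendsto_sub_punctured 0 p).eventually (kernel_eventually_contDiffAt hA1 hA2 _)
  have hKev' : ∀ᶠ x in 𝓝[≠] (0 : ℝ), ∀ p ∈ c.support, ContDiffAt ℝ ∞ K (x - p) :=
    (Finset.eventually_all c.support).2 hKev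
  obtain ⟨M, hM⟩ := hG2t
  have hderiv : ∀ᶠ x in 𝓝[≠] (0 : ℝ),
      HasDerivAt W1 (c.sum (fun p a => a * deriv K (x - p)) + G2 x) x := by
    filter_upwards [hKev', hM] with x hx hy
    refine HasDerivAt.add ?_ ?_
    · unfold transSum Finsupp.sum
      refine HasDerivAt.fun_sum fun p hp => ?_
      have := ((hx p hp).differentiableAt (by simp)).hasDerivAt
      exact (this.comp_sub_const x p).const_mul _
    · rw [hG2']
      exact hasDerivAt_primitive hG2i hy.1
  have hcont : ∀ᶠ x in 𝓝[≠] (0 : ℝ),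
      ContinuousAt (fun x => c.sum (fun p a => a * deriv K (x - p)) + G2 x) x := by
    filter_upwards [hKev', hM] with x hx hy
    refine ContinuousAt.add ?_ hy.1
    unfold Finsupp.sum
    refine tendsto_finsetSum _ fun p hp => ?_
    refine continuousAt_const.mul ?_
    exact ContinuousAt.comp (f := fun x => x - p) (hx p hp).continuousAt_deriv_infty (by fun_prop)
  refine ⟨R, hRt, ?_⟩
  filter_upwards [eventually_eventually_punctured hderiv, eventually_eventually_punctured hcont]
    with x h1 h2
  obtain ⟨r1, r2⟩ := contDiffAt_two_of_hasDerivAt (w := conv U K) (w' := W1)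
    (by rw [hw]; exact h1.mono fun y hy => hasDerivAt_primitive hW1i hy.continuousAt) h1 h2
  refine ⟨r1, ?_⟩
  rw [r2, hsum x, hR]
  ring

end Kernel

/-! ### Blow-up of the second derivative -/

/-- Since R and f'' are bounded near 0, the reverse triangle inequality gives |v''| ≥ |a c₀| |K'| -
M. Both halves of the theorem end here: v is U * K minus a multiple of u, or a multiple of U * K -
f. -/
lemma secondDerivBlowUp_of_eq {K w f v R : ℝ → ℝ} {c₀ a b C : ℝ} (hc₀ : c₀ ≠ 0) (ha : a ≠ 0)
    (hsing : UnboundedAtZero (deriv K)) (hR : Tame R 0)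
    (hw : ∀ᶠ x in 𝓝[≠] 0, ContDiffAt ℝ 2 w x ∧ iteratedDeriv 2 w x = c₀ * deriv K x + R x)
    (hf : ∀ᶠ x in 𝓝[≠] 0, ContDiffAt ℝ 2 f x ∧ |iteratedDeriv 2 f x| ≤ C)
    (hv : ∀ᶠ x in 𝓝[≠] 0, v x = a * w x + b * f x) : SecondDerivBlowUp K v := by
  obtain ⟨D, hD⟩ := hR
  have hA : 0 < |a * c₀| := abs_pos.2 (mul_ne_zero ha hc₀)
  set M := |a| * D + |b| * C with hM
  have hv' : ∀ᶠ x in 𝓝[≠] 0, v =ᶠ[𝓝 x] fun x => a * w x + b * f x :=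
    eventually_eventually_punctured hv
  have key : ∀ᶠ x in 𝓝[≠] 0, |a * c₀| * |deriv K x| - M ≤ |iteratedDeriv 2 v x| := by
    filter_upwards [hv', hw, hf, hD] with x h1 h2 h3 h4
    have e : iteratedDeriv 2 v x = a * c₀ * deriv K x + (a * R x + b * iteratedDeriv 2 f x) := by
      rw [h1.iteratedDeriv_eq 2, iteratedDeriv_fun_add (contDiffAt_const.mul h2.1)
        (contDiffAt_const.mul h3.1), iteratedDeriv_const_mul a h2.1, iteratedDeriv_const_mul b h3.1, h2.2]
      ring
    have b1 : |a * R x + b * iteratedDeriv 2 f x| ≤ M := by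
      refine (abs_add_le _ _).trans ?_
      rw [abs_mul, abs_mul]
      exact add_le_add (mul_le_mul_of_nonneg_left h4.2 (abs_nonneg _))
        (mul_le_mul_of_nonneg_left h3.2 (abs_nonneg _))
    have b2 := abs_sub_abs_le_abs_add (a * c₀ * deriv K x) (a * R x + b * iteratedDeriv 2 f x)
    rw [e, ← abs_mul]
    linarith
  have hle : ∀ s : Set ℝ, s ⊆ {0}ᶜ → (∀ C : ℝ, ∃ᶠ x in 𝓝[s] (0 : ℝ), C < |deriv K x|) →
      ∀ C : ℝ, ∃ᶠ x in 𝓝[s] (0 : ℝ), C < |iteratedDeriv 2 v x| := by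
    intro s hs H C'
    refine ((H ((C' + M) / |a * c₀|)).and_eventually (nhdsWithin_mono _ hs key)).mono ?_
    rintro x ⟨h1, h2⟩
    rw [div_lt_iff₀ hA] at h1
    linarith
  have htop : ∀ s : Set ℝ, s ⊆ {0}ᶜ → Tendsto (fun x => |deriv K x|) (𝓝[s] 0) atTop →
      Tendsto (fun x => |iteratedDeriv 2 v x|) (𝓝[s] 0) atTop := by
    intro s hs H
    refine tendsto_atTop_mono' _ (nhdsWithin_mono _ hs key) ?_
    exact tendsto_atTop_add_const_right _ _ (H.const_mul_atTop hA)
  have hs1 : Ioi (0 : ℝ) ⊆ {0}ᶜ := fun x hx => (show (0 : ℝ) < x from hx).ne'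
  have hs2 : Iio (0 : ℝ) ⊆ {0}ᶜ := fun x hx => (show x < (0 : ℝ) from hx).ne
  refine ⟨?_, ⟨hle _ hs1 hsing.1, hle _ hs2 hsing.2⟩,
    fun H => ⟨htop _ hs1 H.1, htop _ hs2 H.2⟩⟩
  filter_upwards [hv', hw, hf] with x h1 h2 h3
  exact ((contDiffAt_const.mul h2.1).add (contDiffAt_const.mul h3.1)).congr_of_eventuallyEq h1

/-! ### Functions that satisfy Assumption (B) -/

section AssumptionB

variable {a₁ a₂ : ℝ} {N : ℕ} {g : ℝ → ℝ}

lemma AssumptionB.contDiffAt (hg : AssumptionB a₁ a₂ N g) (hN : 2 ≤ N) {x : ℝ}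
    (hx : x ∈ Ioo a₁ 0 ∪ Ioo 0 a₂) : ContDiffAt ℝ 2 g x := by
  have h2 : (2 : WithTop ℕ∞) ≤ N := by exact_mod_cast hN
  rcases hx with hx | hx
  · exact (hg.contDiff_left.contDiffAt (isOpen_Ioo.mem_nhds hx)).of_le h2
  · exact (hg.contDiff_right.contDiffAt (isOpen_Ioo.mem_nhds hx)).of_le h2

lemma AssumptionB.hasDerivAt (hg : AssumptionB a₁ a₂ N g) (hN : 2 ≤ N) {x : ℝ}
    (hx : x ∈ Ioo a₁ 0 ∪ Ioo 0 a₂) : HasDerivAt g (deriv g x) x :=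
  ((hg.contDiffAt hN hx).differentiableAt (by simp)).hasDerivAt

lemma AssumptionB.eventually_bounded (hg : AssumptionB a₁ a₂ N g) (ha₁ : a₁ < 0) (ha₂ : 0 < a₂)
    (hN : 2 ≤ N) :
    ∃ C, ∀ᶠ x in 𝓝[≠] 0, ContDiffAt ℝ 2 g x ∧ |iteratedDeriv 2 g x| ≤ C := by
  obtain ⟨C, hC⟩ := hg.bounded 2 hN
  refine ⟨C, ?_⟩
  filter_upwards [nhdsWithin_le_nhds (Ioo_mem_nhds ha₁ ha₂), self_mem_nhdsWithin] with x hx hx0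
  have : x ∈ Ioo a₁ 0 ∪ Ioo 0 a₂ := by
    rcases lt_or_gt_of_ne (show x ≠ 0 from hx0) with h | h
    · exact Or.inl ⟨hx.1, h⟩
    · exact Or.inr ⟨h, hx.2⟩
  exact ⟨hg.contDiffAt hN this, hC x this⟩

lemma AssumptionB.deriv_memLp (hg : AssumptionB a₁ a₂ N g) (hN : 2 ≤ N) :
    MemLp (deriv g) 2 (volume.restrict (Ioo a₁ a₂)) := by
  obtain ⟨C, hC⟩ := hg.bounded 1 (by omega)
  refine MemLp.of_bound (measurable_deriv g).aestronglyMeasurable C ?_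
  have h0 : ∀ᵐ x : ℝ, x ≠ 0 := by simp [ae_iff]
  filter_upwards [ae_restrict_mem measurableSet_Ioo, ae_restrict_of_ae h0] with x hx hx0
  rw [iteratedDeriv_one] at hC
  refine hC x ?_
  rcases lt_or_gt_of_ne hx0 with h | h
  · exact Or.inl ⟨hx.1, h⟩
  · exact Or.inr ⟨h, hx.2⟩

lemma AssumptionB.deriv_tame (hg : AssumptionB a₁ a₂ N g) (hN : 2 ≤ N) {x : ℝ}
    (hx : x ∈ Ioo a₁ a₂) (hx0 : x ≠ 0) : Tame (deriv g) x := by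
  have hx' : x ∈ Ioo a₁ 0 ∪ Ioo 0 a₂ := by
    rcases lt_or_gt_of_ne hx0 with h | h
    · exact Or.inl ⟨hx.1, h⟩
    · exact Or.inr ⟨h, hx.2⟩
  refine tame_of_eventually_continuousAt ?_
  filter_upwards [(isOpen_Ioo.union isOpen_Ioo).mem_nhds hx'] with y hy
  exact ((hg.contDiffAt hN hy).fderiv_right (m := 0) (by norm_num)).continuousAt.clm_apply
    continuousAt_const

lemma AssumptionB.exists_primitive (hg : AssumptionB a₁ a₂ N g) (ha₁ : a₁ < 0) (ha₂ : 0 < a₂)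
    (hN : 2 ≤ N) :
    (∃ C, ∀ x ∈ Ioo a₁ 0, g x = C + ∫ t in a₁..x, deriv g t) ∧
      ∃ C, ∀ x ∈ Ioo 0 a₂, g x = C + ∫ t in 0..x, deriv g t := by
  have hI : IntegrableOn (deriv g) (Ioo a₁ a₂) := (hg.deriv_memLp hN).integrable (by norm_num)
  exact ⟨exists_primitive_of_hasDerivAt ha₁ (fun x hx => hg.hasDerivAt hN (Or.inl hx))
      (hI.mono_set (Ioo_subset_Ioo_right ha₂.le)),
    exists_primitive_of_hasDerivAt ha₂ (fun x hx => hg.hasDerivAt hN (Or.inr hx))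
      (hI.mono_set (Ioo_subset_Ioo_left ha₁.le))⟩

end AssumptionB

/-! ### Gluing across the boundary of the domain -/

section Glue

variable {a₁ a₂ δ : ℝ}

lemma dom_union_collar (ha₁ : a₁ < 0) (ha₂ : 0 < a₂) (hδ : 0 < δ) :
    dom a₁ a₂ ∪ collar δ a₁ a₂ = Ioo (a₁ - δ) (a₂ + δ) := by
  ext x
  simp only [dom, collar, mem_union, mem_Ioo, mem_Ioc, mem_Ico]
  constructor
  · rintro (h | h | h) <;> constructor <;> linarith [h.1, h.2]
  · rintro ⟨h1, h2⟩
    by_cases h3 : x ≤ a₁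
    · exact Or.inr (Or.inl ⟨h1, h3⟩)
    · by_cases h4 : a₂ ≤ x
      · exact Or.inr (Or.inr ⟨h4, h2⟩)
      · exact Or.inl ⟨not_le.1 h3, not_le.1 h4⟩

/-- The function that is `g` in the domain, `g₀` in the collar and `0` elsewhere. -/
noncomputable def glue (δ a₁ a₂ : ℝ) (g g₀ : ℝ → ℝ) (x : ℝ) : ℝ :=
  indicator (dom a₁ a₂) g x + indicator (collar δ a₁ a₂) g₀ x

lemma measurableSet_dom : MeasurableSet (dom a₁ a₂) := measurableSet_Ioo

lemma measurableSet_collar : MeasurableSet (collar δ a₁ a₂) :=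
  measurableSet_Ioc.union measurableSet_Ico

lemma notMem_collar_of_mem_dom {x : ℝ} (hx : x ∈ dom a₁ a₂) :
    x ∉ collar δ a₁ a₂ := by
  rintro (h | h)
  · exact absurd hx.1 (not_lt.2 h.2)
  · exact absurd hx.2 (not_lt.2 h.1)

lemma glue_of_mem_dom {g g₀ : ℝ → ℝ} {x : ℝ} (hx : x ∈ dom a₁ a₂) : glue δ a₁ a₂ g g₀ x = g x := by
  simp [glue, hx, notMem_collar_of_mem_dom hx]

lemma glue_memLp {g g₀ : ℝ → ℝ} (hg : MemLp g 2 (volume.restrict (dom a₁ a₂)))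
    (hg₀ : MemLp g₀ 2 (volume.restrict (collar δ a₁ a₂))) :
    MemLp (glue δ a₁ a₂ g g₀) 2 volume :=
  ((memLp_indicator_iff_restrict measurableSet_dom).2 hg).add
    ((memLp_indicator_iff_restrict measurableSet_collar).2 hg₀)

lemma glue_congr {g g' g₀ g₀' : ℝ → ℝ} (h : g =ᵐ[volume.restrict (dom a₁ a₂)] g')
    (h₀ : g₀ =ᵐ[volume.restrict (collar δ a₁ a₂)] g₀') :
    glue δ a₁ a₂ g g₀ =ᵐ[volume] glue δ a₁ a₂ g' g₀' :=
  ((ae_eq_restrict_iff_indicator_ae_eq measurableSet_dom).1 h).add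
    ((ae_eq_restrict_iff_indicator_ae_eq measurableSet_collar).1 h₀)

lemma glue_tame {g g₀ : ℝ → ℝ} {p : ℝ} (hp : p ∈ dom a₁ a₂) (hg : Tame g p) :
    Tame (glue δ a₁ a₂ g g₀) p := by
  refine hg.congr (nhdsWithin_le_nhds ?_)
  filter_upwards [isOpen_Ioo.mem_nhds hp] with x hx
  exact (glue_of_mem_dom hx).symm

lemma glue_ae_eq (ha₁ : a₁ < 0) (ha₂ : 0 < a₂) (g g₀ : ℝ → ℝ) :
    (fun x => (indicator (Ioo (a₁ - δ) a₁) g₀ x + indicator (Ioo a₁ 0) g x) +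
      (indicator (Ioo 0 a₂) g x + indicator (Ioo a₂ (a₂ + δ)) g₀ x)) =ᵐ[volume]
      glue δ a₁ a₂ g g₀ := by
  have h0 : ∀ᵐ x : ℝ, x ≠ 0 := by simp [ae_iff]
  have h1 : ∀ᵐ x : ℝ, x ≠ a₁ := by simp [ae_iff]
  have h2 : ∀ᵐ x : ℝ, x ≠ a₂ := by simp [ae_iff]
  filter_upwards [h0, h1, h2] with x h0 h1 h2
  simp only [glue, dom, collar, indicator_apply, mem_union, mem_Ioo, mem_Ioc, mem_Ico]
  rcases lt_or_gt_of_ne h1 with h1 | h1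
  · have e1 : ¬ a₂ < x := by linarith
    have e2 : ¬ a₂ ≤ x := by linarith
    have e3 : ¬ 0 < x := by linarith
    simp [h1, h1.le, h1.not_gt, e1, e2, e3]
  · have e4 : ¬ x ≤ a₁ := h1.not_ge
    rcases lt_or_gt_of_ne h2 with h2 | h2
    · have e2 : ¬ a₂ ≤ x := h2.not_ge
      rcases lt_or_gt_of_ne h0 with h0 | h0
      · simp [h1, h1.not_gt, h2, h2.not_gt, h0, h0.not_gt, e2, e4]
      · simp [h1, h1.not_gt, h2, h2.not_gt, h0, h0.not_gt, e2, e4]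
    · have e5 : ¬ x < 0 := by linarith
      simp [h1.not_gt, h2, h2.le, h2.not_gt, e4, e5]

/-- The glued function is a sum of four cut-off primitives, with possible jumps at a₁ - δ, a₁, 0, a₂
and a₂ + δ. In the collar the representation holds only almost everywhere, as for a Sobolev
function. -/
lemma isPrim_glue (ha₁ : a₁ < 0) (ha₂ : 0 < a₂) (hδ : 0 < δ) {g g₀ k k₀ : ℝ → ℝ} {l r : ℝ}
    (hk : MemLp k 2 (volume.restrict (dom a₁ a₂)))
    (hk₀ : MemLp k₀ 2 (volume.restrict (collar δ a₁ a₂)))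
    (hg₀ : ∀ α β : ℝ, α < β → Ioo α β ⊆ collar δ a₁ a₂ →
      ∃ C, ∀ᵐ x, x ∈ Ioo α β → g₀ x = C + ∫ t in α..x, k₀ t)
    (hg : (∃ C, ∀ x ∈ Ioo a₁ 0, g x = C + ∫ t in a₁..x, k t) ∧
      ∃ C, ∀ x ∈ Ioo 0 a₂, g x = C + ∫ t in 0..x, k t)
    (hl : Tendsto g (𝓝[<] 0) (𝓝 l)) (hr : Tendsto g (𝓝[>] 0) (𝓝 r)) :
    ∃ c : ℝ →₀ ℝ, IsPrim c (glue δ a₁ a₂ k k₀) (glue δ a₁ a₂ g g₀) ∧ c 0 = r - l ∧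
      ∀ p ∈ c.support, p ≠ 0 → |p| = δ → p = a₁ ∧ a₁ = -δ ∨ p = a₂ ∧ a₂ = δ := by
  have : IsFiniteMeasure (volume.restrict (collar δ a₁ a₂)) := by
    refine ⟨?_⟩
    rw [Measure.restrict_apply_univ]
    exact (measure_union_le _ _).trans_lt (by simp)
  have hsub1 : Ioo (a₁ - δ) a₁ ⊆ collar δ a₁ a₂ := fun x hx => Or.inl ⟨hx.1, hx.2.le⟩
  have hsub4 : Ioo a₂ (a₂ + δ) ⊆ collar δ a₁ a₂ := fun x hx => Or.inr ⟨hx.1.le, hx.2⟩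
  have hkI : IntegrableOn k (Ioo a₁ a₂) :=
    MemLp.integrable (μ := volume.restrict (Ioo a₁ a₂)) (by norm_num) hk
  have hkI₀ : IntegrableOn k₀ (collar δ a₁ a₂) := hk₀.integrable (by norm_num)
  have hl1 : a₁ - δ < a₁ := by linarith
  have hl4 : a₂ < a₂ + δ := by linarith
  obtain ⟨C₁, h1⟩ := hg₀ _ _ hl1 hsub1
  obtain ⟨C₄, h4⟩ := hg₀ _ _ hl4 hsub4
  obtain ⟨⟨C₂, h2⟩, C₃, h3⟩ := hg
  have i2 := hkI.mono_set (Ioo_subset_Ioo_right ha₂.le : Ioo a₁ 0 ⊆ Ioo a₁ a₂)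
  have i3 := hkI.mono_set (Ioo_subset_Ioo_left ha₁.le : Ioo 0 a₂ ⊆ Ioo a₁ a₂)
  have e2 := tendsto_nhds_unique (tendsto_of_primitive ha₁ i2 h2).2 hl
  have e3 := tendsto_nhds_unique (tendsto_of_primitive ha₂ i3 h3).1 hr
  have P1 := IsPrim.of_interval hl1 (hkI₀.mono_set hsub1) h1
  have P2 := IsPrim.of_interval ha₁ i2 (Eventually.of_forall h2)
  have P3 := IsPrim.of_interval ha₂ i3 (Eventually.of_forall h3)
  have P4 := IsPrim.of_interval hl4 (hkI₀.mono_set hsub4) h4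
  have P := ((P1.add P2).add (P3.add P4)).congr (glue_ae_eq ha₁ ha₂ k k₀)
    (glue_ae_eq ha₁ ha₂ g g₀)
  -- The coefficient at 0 is now the right limit r minus the left limit l.
  rw [e2, e3] at P
  refine ⟨_, P, ?_, ?_⟩
  · have n1 : a₁ - δ ≠ 0 := by linarith
    have n2 : a₂ + δ ≠ 0 := by linarith
    simp [ha₁.ne, ha₂.ne', n1, n2]
    ring
  · intro p hp hp0 hpδ
    by_contra hcon
    push Not at hcon
    -- The outer ends of the collar are farther than δ from 0, so only a₁ and a₂ can lie at distance
    -- δ.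
    have q1 : a₁ - δ ≠ p := by
      rintro rfl; rw [abs_of_neg (by linarith)] at hpδ; linarith
    have q2 : a₂ + δ ≠ p := by
      rintro rfl; rw [abs_of_pos (by linarith)] at hpδ; linarith
    have q3 : a₁ ≠ p := by
      rintro rfl; rw [abs_of_neg ha₁] at hpδ; exact hcon.1 rfl (by linarith)
    have q4 : a₂ ≠ p := by
      rintro rfl; rw [abs_of_pos ha₂] at hpδ; exact hcon.2 rfl hpδ
    rw [Finsupp.mem_support_iff] at hp
    apply hp
    simp [q1, q2, q3, q4, hp0.symm]

/-- The nonlocal operator in terms of a convolution. -/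
lemma nonlocalOp_eq (ha₁ : a₁ < 0) (ha₂ : 0 < a₂) (hδ : 0 < δ) {K u : ℝ → ℝ}
    (hA1 : AssumptionA1 δ K) (hK2 : MemLp K 2 volume)
    (hu : MemLp u 2 (volume.restrict (dom a₁ a₂ ∪ collar δ a₁ a₂))) {x : ℝ}
    (hx : x ∈ dom a₁ a₂) :
    nonlocalOp K δ a₁ a₂ u x = conv (glue δ a₁ a₂ u u) K x - (∫ y, K y) * u x := by
  have hdisj : glue δ a₁ a₂ u u = indicator (dom a₁ a₂ ∪ collar δ a₁ a₂) u := by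
    ext y
    by_cases h1 : y ∈ dom a₁ a₂
    · simp [glue, h1, notMem_collar_of_mem_dom h1]
    · by_cases h2 : y ∈ collar δ a₁ a₂ <;> simp [glue, h1, h2]
  have hms : MeasurableSet (dom a₁ a₂ ∪ collar δ a₁ a₂) := measurableSet_dom.union measurableSet_collar
  have hU2 : MemLp (glue δ a₁ a₂ u u) 2 volume := by
    rw [hdisj]; exact (memLp_indicator_iff_restrict hms).2 hu
  -- From a point of Ω the kernel does not reach beyond the collar, so the term u(x) K(x - y) may be
  -- integrated over the whole line.
  have hz : ∀ y, y ∉ dom a₁ a₂ ∪ collar δ a₁ a₂ → K (x - y) = 0 := by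
    intro y hy
    rw [dom_union_collar ha₁ ha₂ hδ] at hy
    refine hA1.zero_of_le _ ?_
    by_contra hcon
    obtain ⟨h1, h2⟩ := abs_lt.1 (not_le.1 hcon)
    exact hy ⟨by linarith [hx.1], by linarith [hx.2]⟩
  have hKi : Integrable fun y => K (x - y) := hA1.integrable.comp_sub_left x
  unfold nonlocalOp
  rw [setIntegral_eq_integral_of_forall_compl_eq_zero fun y hy => by simp [hz y hy]]
  have e : ∀ y, (u y - u x) * K (x - y) = glue δ a₁ a₂ u u y * K (x - y) - u x * K (x - y) := by
    intro y
    by_cases hy : y ∈ dom a₁ a₂ ∪ collar δ a₁ a₂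
    · rw [hdisj, indicator_of_mem hy]; ring
    · simp [hz y hy]
  simp only [e]
  rw [integral_sub (conv_integrand_integrable hU2 hK2 x) (hKi.const_mul _), integral_const_mul,
    integral_sub_left_eq_self K volume x, conv]
  ring

end Glue

/-! ### The main theorem -/

section Main

variable {a₁ a₂ δ κ : ℝ} {K : ℝ → ℝ}

/-- If K' is unbounded near ±δ, then `hend` rules out a jump at ±δ; if K itself jumps, then `hdom`
places ±δ in Ω, where the density is `k`. -/
lemma iteratedDeriv_two_conv_glue (ha₁ : a₁ < 0) (ha₂ : 0 < a₂) (hδ : 0 < δ)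
    (hA1 : AssumptionA1 δ K) (hA2 : AssumptionA2 δ K) (hK' : MemLp (deriv K) 2 volume)
    (hκ : Tendsto K (𝓝[<] δ) (𝓝 κ)) (hdom : κ ≠ 0 → -δ ∈ dom a₁ a₂ ∧ δ ∈ dom a₁ a₂)
    (hend : ¬ (∃ C : ℝ, ∀ᶠ x in 𝓝[<] δ, |deriv K x| ≤ C) → a₁ ≠ -δ ∧ a₂ ≠ δ)
    {g g₀ k k₀ : ℝ → ℝ} {l r : ℝ}
    (hk : MemLp k 2 (volume.restrict (dom a₁ a₂)))
    (hk₀ : MemLp k₀ 2 (volume.restrict (collar δ a₁ a₂)))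
    (hg₀ : ∀ α β : ℝ, α < β → Ioo α β ⊆ collar δ a₁ a₂ →
      ∃ C, ∀ᵐ x, x ∈ Ioo α β → g₀ x = C + ∫ t in α..x, k₀ t)
    (hg : (∃ C, ∀ x ∈ Ioo a₁ 0, g x = C + ∫ t in a₁..x, k t) ∧
      ∃ C, ∀ x ∈ Ioo 0 a₂, g x = C + ∫ t in 0..x, k t)
    (hl : Tendsto g (𝓝[<] 0) (𝓝 l)) (hr : Tendsto g (𝓝[>] 0) (𝓝 r))
    (hkt : κ ≠ 0 → Tame k δ ∧ Tame k (-δ)) :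
    ∃ R, Tame R 0 ∧ ∀ᶠ x in 𝓝[≠] 0, ContDiffAt ℝ 2 (conv (glue δ a₁ a₂ g g₀) K) x ∧
      iteratedDeriv 2 (conv (glue δ a₁ a₂ g g₀) K) x = (r - l) * deriv K x + R x := by
  obtain ⟨c, hP, hc0, hc⟩ := isPrim_glue ha₁ ha₂ hδ hk hk₀ hg₀ hg hl hr
  rw [← hc0]
  refine iteratedDeriv_two_conv_kernel hδ hA1 hA2 hK' hκ hP (glue_memLp hk hk₀) ?_ ?_
  · intro p hp hp0 hpδ
    by_contra hcon
    obtain ⟨h1, h2⟩ := hend hcon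
    rcases hc p hp hp0 hpδ with h | h
    · exact h1 h.2
    · exact h2 h.2
  · intro h
    exact ⟨glue_tame (hdom h).2 (hkt h).1, glue_tame (hdom h).1 (hkt h).2⟩

/-- For x near 0 the window (x - δ, x + δ) stays inside Ω, so the values in the collar are
irrelevant and need no regularity. -/
lemma conv_glue_zero_eventually_eq (hA1 : AssumptionA1 δ K) (h1 : a₁ < -δ) (h2 : δ < a₂)
    (u : ℝ → ℝ) :
    ∀ᶠ x in 𝓝 0, conv (glue δ a₁ a₂ u u) K x = conv (glue δ a₁ a₂ u 0) K x := by
  have hn : Ioo (a₁ + δ) (a₂ - δ) ∈ 𝓝 (0 : ℝ) := Ioo_mem_nhds (by linarith) (by linarith)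
  filter_upwards [hn] with x hx
  refine integral_congr_ae (Eventually.of_forall fun y => ?_)
  simp only
  by_cases hy : y ∈ dom a₁ a₂
  · rw [glue_of_mem_dom hy, glue_of_mem_dom hy]
  · rw [hA1.zero_of_le (x - y), mul_zero, mul_zero]
    by_contra hcon
    obtain ⟨h3, h4⟩ := abs_lt.1 (not_le.1 hcon)
    exact hy ⟨by linarith [hx.1], by linarith [hx.2]⟩

lemma dom_mem_punctured (ha₁ : a₁ < 0) (ha₂ : 0 < a₂) : ∀ᶠ x in 𝓝[≠] (0 : ℝ), x ∈ dom a₁ a₂ :=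
  nhdsWithin_le_nhds (Ioo_mem_nhds ha₁ ha₂)

/-- The operator produces a singular second derivative. -/
lemma secondDerivBlowUp_nonlocalOp (ha₁ : a₁ < 0) (ha₂ : 0 < a₂) (hδ : 0 < δ)
    (hA1 : AssumptionA1 δ K) (hA2 : AssumptionA2 δ K) (hK : MemLp K ⊤ volume)
    (hsing : UnboundedAtZero (deriv K)) (hK' : MemLp (deriv K) 2 volume)
    (hκ : Tendsto K (𝓝[<] δ) (𝓝 κ)) (hdom : κ ≠ 0 → -δ ∈ dom a₁ a₂ ∧ δ ∈ dom a₁ a₂)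
    (hend : ¬ (∃ C : ℝ, ∀ᶠ x in 𝓝[<] δ, |deriv K x| ≤ C) → a₁ ≠ -δ ∧ a₂ ≠ δ)
    {N : ℕ} (hN : 2 ≤ N) {u : ℝ → ℝ}
    (hu : MemLp u 2 (volume.restrict (dom a₁ a₂ ∪ collar δ a₁ a₂)))
    (hB : AssumptionB a₁ a₂ N u) (hW : ¬ (a₁ < -δ ∧ δ < a₂) → MemW12 (collar δ a₁ a₂) u) :
    SecondDerivBlowUp K (nonlocalOp K δ a₁ a₂ u) := by
  obtain ⟨l, r, hl, hr, hlr⟩ := hB.jump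
  obtain ⟨C, hC⟩ := hB.eventually_bounded ha₁ ha₂ hN
  have hk := hB.deriv_memLp hN
  have hkt : κ ≠ 0 → Tame (deriv u) δ ∧ Tame (deriv u) (-δ) := fun h =>
    ⟨hB.deriv_tame hN (hdom h).2 hδ.ne', hB.deriv_tame hN (hdom h).1 (by linarith)⟩
  have hop : ∀ᶠ x in 𝓝[≠] 0, nonlocalOp K δ a₁ a₂ u x =
      1 * conv (glue δ a₁ a₂ u u) K x + (-∫ y, K y) * u x := by
    filter_upwards [dom_mem_punctured ha₁ ha₂] with x hx
    rw [nonlocalOp_eq ha₁ ha₂ hδ hA1 (kernel_memLp_two hA1 hK) hu hx]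
    ring
  have hne : r - l ≠ 0 := sub_ne_zero.2 hlr.symm
  -- With ±δ in Ω the collar values are replaced by 0; otherwise the Sobolev assumption provides the
  -- density there.
  by_cases hin : a₁ < -δ ∧ δ < a₂
  · obtain ⟨R, hR, hw⟩ := iteratedDeriv_two_conv_glue (g₀ := 0) (k₀ := 0) ha₁ ha₂ hδ hA1 hA2 hK' hκ
      hdom hend hk MemLp.zero (fun α β _ _ => ⟨0, by simp⟩) (hB.exists_primitive ha₁ ha₂ hN)
      hl hr hkt
    refine secondDerivBlowUp_of_eq (b := -∫ y, K y) hne one_ne_zero hsing hR hw hC ?_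
    filter_upwards [hop, nhdsWithin_le_nhds (conv_glue_zero_eventually_eq hA1 hin.1 hin.2 u)]
      with x h1 h2
    rw [h1, h2]
  · obtain ⟨k₀, hk₀, hg₀⟩ := (hW hin).exists_primitive
    obtain ⟨R, hR, hw⟩ := iteratedDeriv_two_conv_glue ha₁ ha₂ hδ hA1 hA2 hK' hκ
      hdom hend hk hk₀ hg₀ (hB.exists_primitive ha₁ ha₂ hN) hl hr hkt
    exact secondDerivBlowUp_of_eq hne one_ne_zero hsing hR hw hC hop

/-! ### Bootstrapping the regularity of a solution. -/

lemma memLp_restrict_of_continuous {g : ℝ → ℝ} (hg : Continuous g) (a b : ℝ) :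
    MemLp g 2 (volume.restrict (Ioo a b)) := by
  obtain ⟨C, hC⟩ := isCompact_Icc.exists_bound_of_continuousOn (s := Icc a b) hg.continuousOn
  refine MemLp.of_bound hg.aestronglyMeasurable C ?_
  filter_upwards [ae_restrict_mem measurableSet_Ioo] with x hx
  exact hC x (Ioo_subset_Icc_self hx)

lemma transSum_memLp (c : ℝ →₀ ℝ) {g : ℝ → ℝ} (hg : MemLp g 2 volume) :
    MemLp (transSum c g) 2 volume := by
  unfold transSum Finsupp.sum
  exact memLp_finsetSum _ fun p _ =>
    (hg.comp_measurePreserving (measurePreserving_sub_right volume p)).const_mul _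

/-- If the convolution part of the equation is a primitive, then so is the solution away from the
jump. -/
lemma exists_primitive_solution (ha₁ : a₁ < 0) (ha₂ : 0 < a₂) {N : ℕ} (hN : 2 ≤ N) {f G : ℝ → ℝ}
    (hf : AssumptionB a₁ a₂ N f) (hG : Integrable G) (m : ℝ) :
    (∃ C, ∀ x ∈ Ioo a₁ 0, m * (primitive G x - f x) =
        C + ∫ t in a₁..x, m * (G t - deriv f t)) ∧
      ∃ C, ∀ x ∈ Ioo 0 a₂, m * (primitive G x - f x) =
        C + ∫ t in 0..x, m * (G t - deriv f t) := by
  have hI : IntegrableOn (deriv f) (Ioo a₁ a₂) := (hf.deriv_memLp hN).integrable (by norm_num)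
  obtain ⟨⟨C, hC⟩, D, hD⟩ := hf.exists_primitive ha₁ ha₂ hN
  have key : ∀ α β C' : ℝ, Ioo α β ⊆ Ioo a₁ a₂ → (∀ x ∈ Ioo α β, f x = C' + ∫ t in α..x, deriv f t) →
      ∃ C, ∀ x ∈ Ioo α β, m * (primitive G x - f x) =
        C + ∫ t in α..x, m * (G t - deriv f t) := by
    intro α β C' hsub h
    refine ⟨m * (primitive G α - C'), fun x hx => ?_⟩
    have hfi : IntervalIntegrable (deriv f) volume α x := by
      rw [intervalIntegrable_iff_integrableOn_Ioo_of_le hx.1.le]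
      exact hI.mono_set ((Ioo_subset_Ioo_right hx.2.le).trans hsub)
    rw [intervalIntegral.integral_const_mul,
      intervalIntegral.integral_sub hG.intervalIntegrable hfi, h x hx, primitive_eq hG α x]
    ring
  exact ⟨key _ _ _ (Ioo_subset_Ioo_right ha₂.le) hC, key _ _ _ (Ioo_subset_Ioo_left ha₁.le) hD⟩

/-- Solutions with a jump in the data have a singular second derivative. -/
lemma secondDerivBlowUp_solution (ha₁ : a₁ < 0) (ha₂ : 0 < a₂) (hδ : 0 < δ)
    (hA1 : AssumptionA1 δ K) (hA2 : AssumptionA2 δ K) (hK : MemLp K ⊤ volume)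
    (hsing : UnboundedAtZero (deriv K)) (hK' : MemLp (deriv K) 2 volume)
    (hκ : Tendsto K (𝓝[<] δ) (𝓝 κ)) (hdom : κ ≠ 0 → -δ ∈ dom a₁ a₂ ∧ δ ∈ dom a₁ a₂)
    (hend : ¬ (∃ C : ℝ, ∀ᶠ x in 𝓝[<] δ, |deriv K x| ≤ C) → a₁ ≠ -δ ∧ a₂ ≠ δ)
    {N : ℕ} (hN : 2 ≤ N) {f b u : ℝ → ℝ} (hB : AssumptionB a₁ a₂ N f)
    (hb : MemW12 (collar δ a₁ a₂) b) (hu : IsNonlocalSolution K δ a₁ a₂ f b u) :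
    ∃ v : ℝ → ℝ, v =ᵐ[volume.restrict (dom a₁ a₂)] u ∧ SecondDerivBlowUp K v := by
  obtain ⟨l, r, hl, hr, hlr⟩ := hB.jump
  obtain ⟨C, hC⟩ := hB.eventually_bounded ha₁ ha₂ hN
  obtain ⟨k₀, hk₀, hg₀⟩ := hb.exists_primitive
  have hm := kernel_integral_pos hδ hA1 hA2 hsing
  set m := (∫ y, K y)⁻¹ with hm_def
  have hm0 : m ≠ 0 := (inv_pos.2 hm).ne'
  have hK2 := kernel_memLp_two hA1 hK
  have hKi := deriv_kernel_integrable hA1 hK'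
  set U := glue δ a₁ a₂ u u with hU
  have hU2 : MemLp U 2 volume :=
    glue_memLp (hu.memLp.mono_measure (Measure.restrict_mono_set _ subset_union_left))
      (hu.memLp.mono_measure (Measure.restrict_mono_set _ subset_union_right))
  have hUi : Integrable U := by
    have e : U = indicator (Ioo (a₁ - δ) (a₂ + δ)) U := by
      ext x
      rw [← dom_union_collar ha₁ ha₂ hδ]
      by_cases hx : x ∈ dom a₁ a₂ ∪ collar δ a₁ a₂
      · rw [indicator_of_mem hx]
      · rw [indicator_of_notMem hx]
        rw [mem_union, not_or] at hx
        simp [hU, glue, hx.1, hx.2]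
    rw [e, integrable_indicator_iff measurableSet_Ioo]
    exact (hU2.restrict _).integrable (by norm_num)
  set w := conv U K with hw
  have hwc : Continuous w := continuous_conv hU2 hK2
  -- The equation solved for u: a representative defined pointwise, whose one-sided limits at 0 can
  -- be read off because w is continuous.
  set v := fun x => m * (w x - f x) with hv
  have hvu : v =ᵐ[volume.restrict (dom a₁ a₂)] u := by
    filter_upwards [hu.eq_in, ae_restrict_mem measurableSet_dom] with x h1 h2
    rw [nonlocalOp_eq ha₁ ha₂ hδ hA1 hK2 hu.memLp h2] at h1
    have : w x - f x = (∫ y, K y) * u x := by rw [hw, hU]; linarith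
    simp only [hv]
    rw [this, hm_def, inv_mul_cancel_left₀ hm.ne']
  have hUg : glue δ a₁ a₂ v b =ᵐ[volume] U :=
    glue_congr hvu (EventuallyEq.symm hu.eq_collar)
  have hwg : conv (glue δ a₁ a₂ v b) K = w := conv_congr hUg K
  have hvl : Tendsto v (𝓝[<] 0) (𝓝 (m * (w 0 - l))) :=
    (((hwc.tendsto 0).mono_left nhdsWithin_le_nhds).sub hl).const_mul m
  have hvr : Tendsto v (𝓝[>] 0) (𝓝 (m * (w 0 - r))) :=
    (((hwc.tendsto 0).mono_left nhdsWithin_le_nhds).sub hr).const_mul m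
  -- the solution is piecewise in `W^{1,2}`
  set cK := Finsupp.single (-δ) κ - Finsupp.single δ κ
  have hwG := conv_kernel_eq hδ hA1 hA2 hK' hκ hUi
  have hGi : Integrable fun t => transSum cK U t + conv (deriv K) U t :=
    (transSum_integrable cK hUi).add (conv_integrable hKi hUi)
  have hG2 : MemLp (fun t => transSum cK U t + conv (deriv K) U t) 2
      (volume.restrict (dom a₁ a₂)) :=
    ((transSum_memLp cK hU2).restrict _).add
      (memLp_restrict_of_continuous (continuous_conv hK' hU2) _ _)
  have hprim := exists_primitive_solution ha₁ ha₂ hN hB hGi m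
  rw [← hwG] at hprim
  have hf' := hB.deriv_memLp hN
  have hk1 := (hG2.sub hf').const_mul m
  obtain ⟨c, hP, -, -⟩ := isPrim_glue ha₁ ha₂ hδ hk1 hk₀ hg₀ hprim hvl hvr
  -- the derivative has a representative that is continuous near `±δ`
  set h := glue δ a₁ a₂ (fun t => m * (transSum cK U t + conv (deriv K) U t - deriv f t)) k₀
  have hh2 : MemLp h 2 volume := glue_memLp hk1 hk₀
  have hhK := continuous_conv hh2 hK2
  -- The density `h` contains translates of U, known only to be square integrable, so its behaviour
  -- at ±δ is not controlled if K jumps. Since w is also the convolution of K with the glued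
  -- function, it has a second density, built from translates of K and the continuous h * K; that
  -- one is tame.
  have hwW : w = primitive (fun t => transSum c K t + conv h K t) := by
    rw [← hwg]; exact hP.conv_eq hA1.integrable
  have hWi : Integrable (fun t => transSum c K t + conv h K t) :=
    (transSum_integrable c hA1.integrable).add (conv_integrable hP.integrable hA1.integrable)
  have hW2 : MemLp (fun t => transSum c K t + conv h K t) 2 (volume.restrict (dom a₁ a₂)) :=
    ((transSum_memLp c hK2).restrict _).add (memLp_restrict_of_continuous hhK _ _)
  have hprim2 := exists_primitive_solution ha₁ ha₂ hN hB hWi m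
  rw [← hwW] at hprim2
  have hk2 := (hW2.sub hf').const_mul m
  have htame : ∀ p ∈ dom a₁ a₂, p ≠ 0 →
      Tame (fun t => m * (transSum c K t + conv h K t - deriv f t)) p := by
    intro p hp hp0
    have t1 := Tame.transSum (c := c) (p := p) fun q _ => kernel_tame hδ hA1 hA2 hK' (p - q)
    have t2 := (t1.add (tame_of_continuous hhK p)).add ((hB.deriv_tame hN hp hp0).const_mul (-1))
    have t3 := t2.const_mul m
    refine t3.congr (Eventually.of_forall fun x => ?_)
    ring
  obtain ⟨R, hR, hwD⟩ := iteratedDeriv_two_conv_glue ha₁ ha₂ hδ hA1 hA2 hK' hκ hdom hend hk2 hk₀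
    hg₀ hprim2 hvl hvr fun hκ0 =>
      ⟨htame δ (hdom hκ0).2 hδ.ne', htame (-δ) (hdom hκ0).1 (by linarith)⟩
  have hwg' : conv (glue δ a₁ a₂ (fun x => m * (w x - f x)) b) K = w := hwg
  rw [hwg'] at hwD
  refine ⟨v, hvu, secondDerivBlowUp_of_eq (a := m) (b := -m) ?_ hm0 hsing hR hwD hC ?_⟩
  -- The continuous w drops out of the jump of v, which is m (l - r).
  · rw [← mul_sub]
    refine mul_ne_zero hm0 fun h0 => hlr ?_
    linarith
  · exact Eventually.of_forall fun x => by simp only [hv]; ring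

end Main

theorem mainTheorem5 (a₁ a₂ δ : ℝ) (ha₁ : a₁ < 0) (ha₂ : 0 < a₂) (hδ : 0 < δ)
    (K : ℝ → ℝ) (hA1 : AssumptionA1 δ K) (hA2 : AssumptionA2 δ K)
    (hK : MemLp K ⊤ volume)
    (hK'sing : UnboundedAtZero (deriv K))
    (hK' : MemLp (deriv K) 2 volume)
    -- if `K` jumps at `±δ`, then `±δ ∈ Ω`
    (hjump : ¬ Tendsto K (𝓝[<] δ) (𝓝 0) → a₁ < -δ ∧ δ < a₂)
    -- if `K'` is unbounded near `±δ`, then `±δ` are not endpoints of `Ω`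
    (hend : ¬ (∃ C : ℝ, ∀ᶠ x in 𝓝[<] δ, |deriv K x| ≤ C) → a₁ ≠ -δ ∧ a₂ ≠ δ)
    (N : ℕ) (hN : 2 ≤ N) :
    (∀ f b u : ℝ → ℝ, AssumptionB a₁ a₂ N f → MemW12 (collar δ a₁ a₂) b →
      IsNonlocalSolution K δ a₁ a₂ f b u →
        ∃ v : ℝ → ℝ, v =ᵐ[volume.restrict (dom a₁ a₂)] u ∧ SecondDerivBlowUp K v) ∧
    (∀ u : ℝ → ℝ, MemLp u 2 (volume.restrict (dom a₁ a₂ ∪ collar δ a₁ a₂)) →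
      AssumptionB a₁ a₂ N u →
      (¬ (a₁ < -δ ∧ δ < a₂) → MemW12 (collar δ a₁ a₂) u) →
        SecondDerivBlowUp K (nonlocalOp K δ a₁ a₂ u)) := by
  obtain ⟨κ, hκ⟩ := hA2.limit_right
  have hdom : κ ≠ 0 → -δ ∈ dom a₁ a₂ ∧ δ ∈ dom a₁ a₂ := by
    intro h
    obtain ⟨h1, h2⟩ := hjump fun h0 => h (tendsto_nhds_unique hκ h0)
    exact ⟨⟨h1, by linarith⟩, by linarith, h2⟩
  exact ⟨fun f b u hB hb hu => secondDerivBlowUp_solution ha₁ ha₂ hδ hA1 hA2 hK hK'sing hK' hκ hdom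
      hend hN hB hb hu,
    fun u hu hB hW => secondDerivBlowUp_nonlocalOp ha₁ ha₂ hδ hA1 hA2 hK hK'sing hK' hκ hdom hend
      hN hu hB hW⟩
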